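/- Let $n\ge 0$ and let $X$ be a (Hausdorff) complex manifold of dimension $n+1$. Let $(M,\mathcal F)$ be a $C^\infty$-smooth Levi-flat hypersurface of $X$: the set $M\subset X$, with the subspace topology, is covered by foliation charts $\varphi_j\colon\mathcal U_j\to\Omega_j\times(0,1)\subset\mathbb C^n\times\mathbb R$, $x\mapsto(z_j,u_j)$, which are homeomorphisms from open subsets of $M$ with $\Omega_j$ open and connected, whose inverses are $C^\infty$ immersions into $X$ that are holomorphic in $z_j$, and whose transition maps are locally of the form $(z_k,u_k)\mapsto(f_{jk}(z_k,u_k),g_{jk}(u_k))$. The sets $\{u_j=\mathrm{const}\}$ are the plaques, and a leaf is an equivalence class of points for the equivalence relation generated by lying on a common plaque. Let $L$ be a leaf which is embedded in $X$, i.e. $L$ is a non-singular (locally closed) complex hypersurface of $X$: each of its points has an open neighbourhood $W$ in $X$ with a holomorphic $w\colon W\to\mathbb C$ such that $dw\neq0$ everywhere on $W$ and $L\cap W=\{w=0\}$. Assume that (i) the holonomy group $\mathcal H(L)$ of $\mathcal F$ along $L$ (the group of germs at $0$ of $C^\infty$ diffeomorphisms of $\mathbb R$ fixing $0$ given by the return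 maps, along closed curves in $L$ at a base point, on a transversal with coordinate centred at that point) is generated by $C^2$-flat germs, i.e. germs having the same $2$-jet at $0$ as the identity; and (ii) there is a $C^\infty$ retraction $p\colon M\to L$ (so $p|_L=\mathrm{id}_L$) whose restriction to each leaf of $\mathcal F$ is holomorphic. Then the pair $(L,X)$ has the jet extension property: for every integer $k\ge1$ the restriction map $$H^0(L,\mathcal O_X/I_L^{k+1})\longrightarrow H^0(L,\mathcal O_X/I_L)=H^0(L,\mathcal O_L)$$ is surjective, where $I_L\subset\mathcal O_X$ is the ideal sheaf of holomorphic functions vanishing on $L$. In other words, every holomorphic function on $L$ extends to a section over $L$ of $\mathcal O_X/I_L^{k+1}$. -/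

import Mathlib

open Set Filter Topology
open scoped Manifold ContDiff

noncomputable section

/-! ### Complex manifolds

A complex manifold of dimension `n + 1` is a space charted on `Cn (n + 1)` with holomorphic
transition maps. Its underlying smooth structure is the one given by the same charts, read over `ℝ`
through the model `𝓘(ℝ, Cn (n + 1))`. -/

/-- The complex vector space `ℂⁿ`. -/
abbrev Cn (n : ℕ) : Type := EuclideanSpace ℂ (Fin n)

/-! ### Levi-flat hypersurfaces -/

/-- A foliation chart of a subset `M` of a complex manifold `X` of dimension `n + 1`: a homeomorphism
`φ` from a relatively open subset of `M` to `Ω × (0, 1) ⊆ ℂⁿ × ℝ`, with `Ω` open and connected, whose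
inverse, seen as a map to `X`, is a smooth immersion that is holomorphic in the first variable. -/
structure FoliationChart (n : ℕ) {X : Type*} [TopologicalSpace X] [ChartedSpace (Cn (n + 1)) X]
    (M : Set X) where
  /-- the chart -/
  φ : OpenPartialHomeomorph M (Cn n × ℝ)
  /-- the range of the leafwise coordinate -/
  Ω : Set (Cn n)
  isOpen_Ω : IsOpen Ω
  isConnected_Ω : IsConnected Ω
  target_eq : φ.target = Ω ×ˢ Ioo (0 : ℝ) 1
  smooth : ContMDiffOn 𝓘(ℝ, Cn n × ℝ) 𝓘(ℝ, Cn (n + 1)) ∞ (fun q => (φ.symm q : X)) φ.target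
  immersion : ∀ q ∈ φ.target, Function.Injective
    (mfderiv 𝓘(ℝ, Cn n × ℝ) 𝓘(ℝ, Cn (n + 1)) (fun q => (φ.symm q : X)) q)
  holomorphic : ∀ u ∈ Ioo (0 : ℝ) 1,
    MDifferentiableOn 𝓘(ℂ, Cn n) 𝓘(ℂ, Cn (n + 1)) (fun z => (φ.symm (z, u) : X)) Ω

namespace FoliationChart

variable {n : ℕ} {X : Type*} [TopologicalSpace X] [ChartedSpace (Cn (n + 1)) X] {M : Set X}

/-- The transverse coordinate `u` of a foliation chart. -/
def u (c : FoliationChart n M) (x : M) : ℝ := (c.φ x).2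

/-- The plaque `{u = a}` of a foliation chart. -/
def plaque (c : FoliationChart n M) (a : ℝ) : Set M := {x | x ∈ c.φ.source ∧ c.u x = a}

end FoliationChart

/-- A smooth Levi-flat hypersurface of a complex manifold `X` of dimension `n + 1`: a subset `M`
of `X` covered by foliation charts whose changes of coordinates have (locally) the form
`(z, u) ↦ (f (z, u), g u)`. That `f` and `g` are smooth and that `f` is holomorphic in `z` is
automatic here, since the inverse charts are smooth immersions into `X`, holomorphic in `z`, and
homeomorphisms onto open subsets of `M ⊆ X`. -/
structure LeviFlatHypersurface (n : ℕ) (X : Type*) [TopologicalSpace X]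
    [ChartedSpace (Cn (n + 1)) X] where
  /-- the underlying set -/
  carrier : Set X
  /-- the foliated atlas -/
  charts : Set (FoliationChart n carrier)
  cover : ∀ x : carrier, ∃ c ∈ charts, x ∈ c.φ.source
  compatible : ∀ c ∈ charts, ∀ c' ∈ charts, ∀ x ∈ c.φ.source ∩ c'.φ.source,
    ∃ g : ℝ → ℝ, ∀ᶠ y in 𝓝 x, c'.u y = g (c.u y)

/-! ### Germs of diffeomorphisms of the line -/

/-- Maps `ℝ → ℝ` that fix `0` and are smooth in a neighbourhood of `0`, under composition. -/
def smoothMapsFixingZero : Submonoid (Function.End ℝ) where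
  carrier := {f | f 0 = 0 ∧ ∀ᶠ x in 𝓝 (0 : ℝ), ContDiffAt ℝ ∞ f x}
  one_mem' := ⟨rfl, Eventually.of_forall fun _ => contDiffAt_id⟩
  mul_mem' := by
    rintro f g ⟨hf, hf'⟩ ⟨hg, hg'⟩
    refine ⟨?_, ?_⟩
    · change f (g 0) = 0
      rw [hg, hf]
    · have hc : Tendsto g (𝓝 0) (𝓝 0) := by
        have h := hg'.self_of_nhds.continuousAt.tendsto
        rwa [hg] at h
      filter_upwards [hg', hc.eventually hf'] with x h1 h2
      exact h2.comp x h1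

/-- Two maps are identified if they agree in a neighbourhood of `0`. -/
def germCon : Con smoothMapsFixingZero where
  r f g := (f.1 : ℝ → ℝ) =ᶠ[𝓝 0] (g.1 : ℝ → ℝ)
  iseqv := ⟨fun _ => EventuallyEq.rfl, fun h => h.symm, fun h h' => h.trans h'⟩
  mul' := by
    intro f f' g g' hf hg
    have hc : Tendsto (g.1 : ℝ → ℝ) (𝓝 0) (𝓝 0) := by
      have h := g.2.2.self_of_nhds.continuousAt.tendsto
      rwa [g.2.1] at h
    change (fun x => f.1 (g.1 x)) =ᶠ[𝓝 0] (fun x => f'.1 (g'.1 x))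
    filter_upwards [hg, hc.eventually hf] with x h1 h2
    rw [h2]
    exact congrArg f'.1 h1

/-- The monoid of germs at `0` of smooth maps `(ℝ, 0) → (ℝ, 0)`. -/
abbrev SmoothGerm : Type := germCon.Quotient

/-- The group of germs at `0` of local smooth diffeomorphisms of `ℝ` fixing `0`. -/
abbrev DiffGerm : Type := SmoothGermˣ

/-- A germ is `C^r`-flat if it is tangent to the identity to order `r` at `0`. -/
def DiffGerm.IsFlat (r : ℕ) (g : DiffGerm) : Prop :=
  ∃ f : smoothMapsFixingZero, (f : SmoothGerm) = (g : SmoothGerm) ∧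
    ∀ k ≤ r, iteratedDeriv k (f.1 : ℝ → ℝ) 0 = iteratedDeriv k (fun x : ℝ => x) 0

/-! ### Leaves and holonomy -/

namespace LeviFlatHypersurface

variable {n : ℕ} {X : Type*} [TopologicalSpace X] [ChartedSpace (Cn (n + 1)) X]

/-- Two points lie on a common plaque of one of the foliation charts. -/
def SamePlaque (M : LeviFlatHypersurface n X) (x y : M.carrier) : Prop :=
  ∃ c ∈ M.charts, ∃ a : ℝ, x ∈ c.plaque a ∧ y ∈ c.plaque a

/-- The leaf of the foliation through the point `x`, as a subset of `X`. -/
def leaf (M : LeviFlatHypersurface n X) (x : M.carrier) : Set X :=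
  Subtype.val '' {y : M.carrier | Relation.EqvGen M.SamePlaque x y}

/-- `h` is the germ of the change from the transverse coordinate of `c` to the one of `c'` at `x`,
both coordinates being centred at `x`. -/
def IsTransition (M : LeviFlatHypersurface n X) (c c' : FoliationChart n M.carrier)
    (x : M.carrier) (h : SmoothGerm) : Prop :=
  ∃ f : smoothMapsFixingZero, (f : SmoothGerm) = h ∧
    ∀ᶠ y in 𝓝 x, c'.u y - c'.u x = f.1 (c.u y - c.u x)

/-- Transport of a transversal along a curve. `M.Transport γ c₀ t c g` says that moving the
transversal with coordinate `u_{c₀}` at `γ 0` along `γ` up to time `t`, through finitely many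
foliation charts the last of which is `c`, gives the germ `g` from the (centred) coordinate
`u_{c₀}` at `γ 0` to the (centred) coordinate `u_c` at `γ t`. The curve has to run inside
plaques, hence inside a leaf. -/
inductive Transport (M : LeviFlatHypersurface n X) {x y : M.carrier} (γ : Path x y)
    (c₀ : FoliationChart n M.carrier) :
    unitInterval → FoliationChart n M.carrier → SmoothGerm → Prop
  | start : c₀ ∈ M.charts → x ∈ c₀.φ.source → Transport M γ c₀ 0 c₀ 1
  | move {s t : unitInterval} {c : FoliationChart n M.carrier} {g : SmoothGerm} (a : ℝ) :
      Transport M γ c₀ s c g → s ≤ t → (∀ r ∈ Icc s t, γ r ∈ c.plaque a) →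
      Transport M γ c₀ t c g
  | change {t : unitInterval} {c c' : FoliationChart n M.carrier} {g h : SmoothGerm} :
      Transport M γ c₀ t c g → c' ∈ M.charts → γ t ∈ c'.φ.source →
      M.IsTransition c c' (γ t) h → Transport M γ c₀ t c' (h * g)

/-- The holonomy group, at the base point `x` and in the transverse coordinate of the chart `c₀`
around `x`, of the leaf through `x`: the set of all return maps along closed curves at `x` in the
leaf. -/
def holonomyGroup (M : LeviFlatHypersurface n X) (x : M.carrier)
    (c₀ : FoliationChart n M.carrier) : Set DiffGerm :=
  {g | ∃ γ : Path x x, M.Transport γ c₀ 1 c₀ (g : SmoothGerm)}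

/-- A `C^∞` retraction of `M` onto the subset `L` of `M` that is holomorphic along the leaves.
Smoothness and leafwise holomorphy are those of `p` as a map to `X`; for an embedded submanifold
`L` this is the same as for `p` as a map to `L`. -/
structure IsLeafwiseHolomorphicRetraction (M : LeviFlatHypersurface n X) (L : Set X)
    (p : M.carrier → X) : Prop where
  maps_to : ∀ x, p x ∈ L
  retracts : ∀ x : M.carrier, (x : X) ∈ L → p x = x
  smooth : ∀ c ∈ M.charts, ContMDiffOn 𝓘(ℝ, Cn n × ℝ) 𝓘(ℝ, Cn (n + 1)) ∞
    (fun q => p (c.φ.symm q)) c.φ.target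
  holomorphic : ∀ c ∈ M.charts, ∀ u ∈ Ioo (0 : ℝ) 1,
    MDifferentiableOn 𝓘(ℂ, Cn n) 𝓘(ℂ, Cn (n + 1)) (fun z => p (c.φ.symm (z, u))) c.Ω

end LeviFlatHypersurface

/-! ### Complex hypersurfaces and jets along them -/

section Jets

variable (n : ℕ) {X : Type*} [TopologicalSpace X] [ChartedSpace (Cn (n + 1)) X]

/-- `S` is a non-singular (embedded, locally closed) complex hypersurface of `X`: locally the zero
set of a holomorphic function whose differential does not vanish. -/
def IsComplexHypersurface (S : Set X) : Prop :=
  ∀ x ∈ S, ∃ W : Set X, IsOpen W ∧ x ∈ W ∧ ∃ w : X → ℂ,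
    MDifferentiableOn 𝓘(ℂ, Cn (n + 1)) 𝓘(ℂ, ℂ) w W ∧
    (∀ y ∈ W, mfderiv 𝓘(ℂ, Cn (n + 1)) 𝓘(ℂ, ℂ) w y ≠ 0) ∧
    (∀ y ∈ W, y ∈ S ↔ w y = 0)

/-- Holomorphic functions on a non-singular complex hypersurface `S`: the functions that are
holomorphic in every holomorphic parametrization, that is, after composition with every holomorphic
map from an open subset of `ℂⁿ`, `n = dim S`, to `X` with values in `S`. -/
def HolomorphicFunctions (S : Set X) : Type _ :=
  {f : S → ℂ // ∀ (U : Set (Cn n)) (φ : Cn n → S), IsOpen U →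
    MDifferentiableOn 𝓘(ℂ, Cn n) 𝓘(ℂ, Cn (n + 1)) (fun z => (φ z : X)) U →
    DifferentiableOn ℂ (fun z => f (φ z)) U}

/-- The stalk `𝒪_{X,x}`: the ring of germs at `x` of holomorphic functions. -/
def holomorphicGerms (x : X) : Subring (Germ (𝓝 x) ℂ) where
  carrier := {g | ∃ F : X → ℂ, (∀ᶠ y in 𝓝 x, MDifferentiableAt 𝓘(ℂ, Cn (n + 1)) 𝓘(ℂ, ℂ) F y) ∧
    (F : Germ (𝓝 x) ℂ) = g}
  mul_mem' := by
    rintro _ _ ⟨F, hF, rfl⟩ ⟨G, hG, rfl⟩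
    exact ⟨F * G, by filter_upwards [hF, hG] with y h1 h2 using h1.mul h2, rfl⟩
  one_mem' := ⟨fun _ => 1, Eventually.of_forall fun _ => mdifferentiableAt_const, rfl⟩
  add_mem' := by
    rintro _ _ ⟨F, hF, rfl⟩ ⟨G, hG, rfl⟩
    exact ⟨F + G, by filter_upwards [hF, hG] with y h1 h2 using h1.add h2, rfl⟩
  zero_mem' := ⟨fun _ => 0, Eventually.of_forall fun _ => mdifferentiableAt_const, rfl⟩
  neg_mem' := by
    rintro _ ⟨F, hF, rfl⟩
    exact ⟨-F, by filter_upwards [hF] with y h1 using h1.neg, rfl⟩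

/-- The stalk at `x` of the defining ideal sheaf `I_S`: germs of holomorphic functions that
vanish on `S` near `x`. -/
def idealGerms (S : Set X) (x : X) : Ideal (holomorphicGerms n x) where
  carrier := {g | ∃ F : X → ℂ, (F : Germ (𝓝 x) ℂ) = g.1 ∧ ∀ᶠ y in 𝓝 x, y ∈ S → F y = 0}
  add_mem' := by
    rintro a b ⟨F, hF, hF'⟩ ⟨G, hG, hG'⟩
    refine ⟨F + G, ?_, ?_⟩
    · rw [Germ.coe_add, hF, hG]; rfl
    · filter_upwards [hF', hG'] with y h1 h2 hy
      simp [h1 hy, h2 hy]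
  zero_mem' := ⟨fun _ => 0, rfl, Eventually.of_forall fun _ _ => rfl⟩
  smul_mem' := by
    rintro a b ⟨G, hG, hG'⟩
    obtain ⟨F, -, hF⟩ := a.2
    refine ⟨F * G, ?_, ?_⟩
    · rw [Germ.coe_mul, hF, hG]; rfl
    · filter_upwards [hG'] with y h2 hy
      simp [h2 hy]

/-- Sections over `S` of the sheaf `𝒪_X / I_S^(k+1)`: families of elements of the stalks
`𝒪_{X,x} / I_{S,x}^(k+1)`, `x ∈ S`, that are locally induced by a holomorphic function on an open
subset of `X`. -/
def JetSections (S : Set X) (k : ℕ) : Type _ :=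
  {s : (x : S) → holomorphicGerms n (x : X) ⧸ idealGerms n S (x : X) ^ (k + 1) //
    ∀ x : S, ∃ W : Set X, IsOpen W ∧ (x : X) ∈ W ∧ ∃ F : X → ℂ,
      MDifferentiableOn 𝓘(ℂ, Cn (n + 1)) 𝓘(ℂ, ℂ) F W ∧
      ∀ y : S, (y : X) ∈ W → ∃ g : holomorphicGerms n (y : X),
        g.1 = (F : Germ (𝓝 (y : X)) ℂ) ∧ s y = Ideal.Quotient.mk _ g}

/-- The value at `x ∈ S` of an element of `𝒪_{X,x} / I_{S,x}^(k+1)`. -/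
def jetValue (S : Set X) (k : ℕ) (x : S) :
    (holomorphicGerms n (x : X) ⧸ idealGerms n S (x : X) ^ (k + 1)) →+* ℂ :=
  Ideal.Quotient.lift _ (((Germ.valueRingHom : Germ (𝓝 (x : X)) ℂ →+* ℂ)).comp
    (holomorphicGerms n (x : X)).subtype) (by
      intro a ha
      obtain ⟨F, hF, hF'⟩ := Ideal.pow_le_self (Nat.succ_ne_zero k) ha
      change Germ.value a.1 = 0
      rw [← hF]
      exact hF'.self_of_nhds x.2)

/-- The restriction map `H⁰(S, 𝒪_X / I_S^(k+1)) → H⁰(S, 𝒪_X / I_S) = H⁰(S, 𝒪_S)`. -/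
def restrictJets (S : Set X) (k : ℕ) (s : JetSections n S k) : HolomorphicFunctions n S :=
  ⟨fun x => jetValue n S k x (s.1 x), by
    intro U φ hU hφ z hz
    obtain ⟨W, hW, hxW, F, hF, hs⟩ := s.2 (φ z)
    have hφz := (hφ z hz).mdifferentiableAt (hU.mem_nhds hz)
    have h1 : MDifferentiableAt 𝓘(ℂ, Cn n) 𝓘(ℂ, ℂ) (fun z => F (φ z : X)) z :=
      ((hF (φ z) hxW).mdifferentiableAt (hW.mem_nhds hxW)).comp z hφz
    have h2 : (fun z => jetValue n S k (φ z) (s.1 (φ z))) =ᶠ[𝓝 z] fun z => F (φ z : X) := by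
      filter_upwards [hφz.continuousAt (hW.mem_nhds hxW)] with y hy
      obtain ⟨g, hg, hg'⟩ := hs (φ y) hy
      rw [hg']
      change Germ.value g.1 = _
      rw [hg]
      rfl
    exact (h1.differentiableAt.congr_of_eventuallyEq h2).differentiableWithinAt⟩

/-- The `k`-jet extension property of the pair `(S, X)`. -/
def HasJetExtension (S : Set X) (k : ℕ) : Prop :=
  Function.Surjective (restrictJets n S k)

/-- The jet extension property of the pair `(S, X)`. -/
def HasJetExtensionProperty (S : Set X) : Prop :=
  ∀ k : ℕ, 1 ≤ k → HasJetExtension n S k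

end Jets

end

/-! Pull a holomorphic `f` on the leaf `L` back by the retraction: `g = f ∘ p` is smooth on `M`,
holomorphic along the leaves, and equal to `f` on `L`. Its transverse Taylor expansion along `L`
then has coefficients holomorphic on `L`, and these convert into holomorphic data on `X`.

Near a point of `L` let `ψ (z, u)` parametrize `M`, with `L` given by `u = u₀`, and let `w` be a
holomorphic equation of `L`. Then `w ∘ ψ = (u - u₀) v` with `v` nonvanishing and holomorphic in `z`
(`exists_factor`). Hence powers of `w` can replace powers of `u - u₀`: correcting one order at a
time, `exists_jet` and `exists_jet_bound` produce a holomorphic `G` with `G - g = O(|w|^k)` on `M`.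

Such a `G` is unique modulo `w^k`. A holomorphic function which is `O(|w|^k)` merely on the real
hypersurface `M` is divisible by `w^k` (`exists_eq_pow_mul`), because `M` leaves `L` in a direction
not annihilated by `dw`. By `exists_sub_eq_pow_mul`, applied at order `k + 1`, the local `G`
therefore agree modulo `I_L^(k+1)` and form a global section without any correction. It restricts to
`f` because `p` is the identity on `L`. -/

/-! ### Smoothness of holomorphic functions of several variables. -/

section HolomorphicSmooth

variable {E : Type*} [NormedAddCommGroup E] [NormedSpace ℂ E]

/-- Cauchy's estimate on each complex line through `x`; halving the radius keeps the closed disc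
inside the open ball. -/
theorem norm_fderiv_le_of_forall_ball {f : E → ℂ} {x : E} {r M : ℝ} (hr : 0 < r)
    (hf : DifferentiableOn ℂ f (Metric.ball x r)) (hM : ∀ y ∈ Metric.ball x r, ‖f y‖ ≤ M) :
    ‖fderiv ℂ f x‖ ≤ M / (r / 2) := by
  have hM0 : 0 ≤ M := (norm_nonneg _).trans (hM x (Metric.mem_ball_self hr))
  refine ContinuousLinearMap.opNorm_le_bound _ (by positivity) fun v => ?_
  rcases eq_or_ne v 0 with rfl | hv
  · simp
  have hv' : 0 < ‖v‖ := norm_pos_iff.mpr hv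
  set R := r / 2 / ‖v‖ with hR
  have hR0 : 0 < R := by positivity
  have hmem : ∀ ζ : ℂ, ‖ζ‖ ≤ R → x + ζ • v ∈ Metric.ball x r := by
    intro ζ hζ
    rw [Metric.mem_ball, dist_eq_norm, add_sub_cancel_left, norm_smul]
    calc ‖ζ‖ * ‖v‖ ≤ R * ‖v‖ := by gcongr
      _ = r / 2 := by rw [hR]; field_simp
      _ < r := by linarith
  have hd : ∀ ζ : ℂ, ‖ζ‖ ≤ R → HasDerivAt (fun ζ : ℂ => f (x + ζ • v))
      (fderiv ℂ f (x + ζ • v) v) ζ := by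
    intro ζ hζ
    have h1 := (hf.differentiableAt (Metric.isOpen_ball.mem_nhds (hmem ζ hζ))).hasFDerivAt
    have h2 : HasDerivAt (fun ζ : ℂ => x + ζ • v) v ζ := by
      simpa using ((hasDerivAt_id ζ).smul_const v).const_add x
    exact h1.comp_hasDerivAt ζ h2
  have h3 := Complex.norm_deriv_le_of_forall_mem_sphere_norm_le (c := 0) (C := M) hR0
    (f := fun ζ : ℂ => f (x + ζ • v)) (DifferentiableOn.diffContOnCl (by
      rw [closure_ball _ hR0.ne']
      intro ζ hζ
      exact (hd ζ (by simpa using hζ)).differentiableAt.differentiableWithinAt))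
    (fun ζ hζ => hM _ (hmem ζ (by simpa using (mem_sphere_iff_norm.mp hζ).le)))
  rw [(hd 0 (by simpa using hR0.le)).deriv] at h3
  simp only [zero_smul, add_zero] at h3
  refine h3.trans_eq ?_
  rw [hR]; field_simp

theorem circleMap_weight_continuous {r : ℝ} (hr : 0 < r) :
    Continuous fun θ : ℝ => deriv (circleMap 0 r) θ * ((circleMap 0 r θ) ^ 2)⁻¹ := by
  have h : ∀ θ, (circleMap 0 r θ) ^ 2 ≠ 0 := fun θ => pow_ne_zero _ (circleMap_ne_center hr.ne')
  simp only [deriv_circleMap]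
  exact ((continuous_circleMap 0 r).mul continuous_const).mul
    (((continuous_circleMap 0 r).pow 2).inv₀ h)

variable [FiniteDimensional ℂ E]

/-- Cauchy's formula on a circle in the direction `v` writes the directional derivative as an
integral of values of `f`, which can be differentiated under the integral sign. The dominating bound
is Cauchy's estimate, so continuity of the derivative is not needed beforehand. -/
theorem differentiableOn_fderiv_apply_complex {f : E → ℂ} {U : Set E} (hf : DifferentiableOn ℂ f U)
    (hU : IsOpen U) (v : E) : DifferentiableOn ℂ (fun x => fderiv ℂ f x v) U := by
  intro x₀ hx₀
  apply DifferentiableAt.differentiableWithinAt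
  borelize E
  obtain ⟨M, δ, hδ, hδU, hM⟩ : ∃ M : ℝ, ∃ δ > 0, Metric.ball x₀ δ ⊆ U ∧
      ∀ y ∈ Metric.ball x₀ δ, ‖f y‖ ≤ M := by
    have h1 : ∀ᶠ y in 𝓝 x₀, ‖f y‖ < ‖f x₀‖ + 1 :=
      (hf.continuousOn.continuousAt (hU.mem_nhds hx₀)).norm.eventually_lt_const (by linarith)
    obtain ⟨δ, hδ, h⟩ := Metric.eventually_nhds_iff_ball.mp (h1.and (hU.mem_nhds hx₀))
    exact ⟨_, δ, hδ, fun y hy => (h y hy).2, fun y hy => (h y hy).1.le⟩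
  -- Circles of radius `r` centred in the `ρ`-ball stay in the `2ρ`-ball, and every point there
  -- still has a ball of radius `ρ` inside the `δ`-ball, as Cauchy's estimate requires.
  set ρ := δ / 4 with hρ
  have hρ0 : 0 < ρ := by positivity
  have hball : ∀ y ∈ Metric.ball x₀ (2 * ρ), Metric.ball y ρ ⊆ Metric.ball x₀ δ := by
    intro y hy z hz
    rw [Metric.mem_ball] at *
    linarith [dist_triangle z y x₀]
  have hfd : ∀ y ∈ Metric.ball x₀ (2 * ρ), ‖fderiv ℂ f y‖ ≤ M / (ρ / 2) := fun y hy =>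
    norm_fderiv_le_of_forall_ball hρ0 (hf.mono ((hball y hy).trans hδU))
      fun z hz => hM z (hball y hy hz)
  set r := ρ / (‖v‖ + 1) with hr
  have hr0 : 0 < r := by positivity
  have hmem : ∀ x ∈ Metric.ball x₀ ρ, ∀ ζ : ℂ, ‖ζ‖ ≤ r → x + ζ • v ∈ Metric.ball x₀ (2 * ρ) := by
    intro x hx ζ hζ
    rw [Metric.mem_ball] at *
    have h1 : dist (x + ζ • v) x < ρ := by
      rw [dist_eq_norm, add_sub_cancel_left, norm_smul]
      calc ‖ζ‖ * ‖v‖ ≤ r * ‖v‖ := by gcongr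
        _ < r * (‖v‖ + 1) := by gcongr; linarith
        _ = ρ := by rw [hr]; field_simp
    linarith [dist_triangle (x + ζ • v) x x₀]
  have hsub : Metric.ball x₀ (2 * ρ) ⊆ Metric.ball x₀ δ :=
    Metric.ball_subset_ball (by rw [hρ]; linarith)
  have hdiff : ∀ y ∈ Metric.ball x₀ (2 * ρ), DifferentiableAt ℂ f y := fun y hy =>
    hf.differentiableAt (hU.mem_nhds (hδU (hsub hy)))
  have hnorm : ∀ θ, ‖circleMap 0 r θ‖ ≤ r := fun θ => by simp [abs_of_pos hr0]
  set c : ℝ → ℂ := fun θ : ℝ => deriv (circleMap 0 r) θ * ((circleMap 0 r θ) ^ 2)⁻¹ with hc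
  have hcc : Continuous c := circleMap_weight_continuous hr0
  have key : ∀ x ∈ Metric.ball x₀ ρ, fderiv ℂ f x v =
      (2 * Real.pi * Complex.I : ℂ)⁻¹ *
        ∫ θ in (0 : ℝ)..2 * Real.pi, c θ * f (x + circleMap 0 r θ • v) := by
    intro x hx
    set V : Set ℂ := (fun ζ : ℂ => x + ζ • v) ⁻¹' Metric.ball x₀ (2 * ρ) with hV
    have hVo : IsOpen V := Metric.isOpen_ball.preimage (by fun_prop)
    have hd : ∀ ζ ∈ V, HasDerivAt (fun ζ : ℂ => f (x + ζ • v)) (fderiv ℂ f (x + ζ • v) v) ζ := by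
      intro ζ hζ
      have h2 : HasDerivAt (fun ζ : ℂ => x + ζ • v) v ζ := by
        simpa using ((hasDerivAt_id ζ).smul_const v).const_add x
      exact (hdiff _ hζ).hasFDerivAt.comp_hasDerivAt ζ h2
    have h0 : (0 : ℂ) ∈ V := hmem x hx 0 (by simpa using hr0.le)
    have h := Complex.two_pi_I_inv_smul_circleIntegral_sub_sq_inv_smul_of_differentiable
      (c := 0) (w₀ := 0) (R := r) hVo (fun ζ hζ => hmem x hx ζ (by simpa using hζ))
      (fun ζ hζ => (hd ζ hζ).differentiableAt.differentiableWithinAt) (by simpa using hr0)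
    rw [(hd 0 h0).deriv] at h
    simp only [zero_smul, add_zero, sub_zero, smul_eq_mul, circleIntegral] at h
    rw [← h]
    congr 1
    apply intervalIntegral.integral_congr
    intro θ _
    simp only [hc]
    ring
  have hcont : ∀ x ∈ Metric.ball x₀ ρ, Continuous fun θ : ℝ => c θ * f (x + circleMap 0 r θ • v) := by
    intro x hx
    refine hcc.mul (continuous_iff_continuousAt.mpr fun θ => ?_)
    refine ContinuousAt.comp (f := fun θ : ℝ => x + circleMap 0 r θ • v)
      (hdiff _ (hmem x hx _ (hnorm θ))).continuousAt ?_
    have := continuous_circleMap 0 r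
    fun_prop
  have hint := intervalIntegral.hasFDerivAt_integral_of_dominated_of_fderiv_le (𝕜 := ℂ)
    (μ := MeasureTheory.volume) (a := 0) (b := 2 * Real.pi) (x₀ := x₀)
    (F := fun x θ => c θ * f (x + circleMap 0 r θ • v))
    (F' := fun x θ => c θ • fderiv ℂ f (x + circleMap 0 r θ • v))
    (bound := fun θ => ‖c θ‖ * (M / (ρ / 2)))
    (Metric.ball_mem_nhds x₀ hρ0)
    (by filter_upwards [Metric.ball_mem_nhds x₀ hρ0] with x hx
        exact (hcont x hx).aestronglyMeasurable)
    ((hcont x₀ (Metric.mem_ball_self hρ0)).intervalIntegrable _ _)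
    (by
      have : SecondCountableTopology (E →L[ℂ] ℂ) := by
        have := FiniteDimensional.proper ℂ (E →L[ℂ] ℂ)
        infer_instance
      have h1 : Measurable fun θ : ℝ => fderiv ℂ f (x₀ + circleMap 0 r θ • v) :=
        (measurable_fderiv ℂ f).comp (by
          have := continuous_circleMap 0 r
          apply Continuous.measurable
          fun_prop)
      exact (hcc.aestronglyMeasurable.smul h1.aestronglyMeasurable))
    (Eventually.of_forall fun θ _ x hx => by
      rw [norm_smul]
      gcongr
      exact hfd _ (hmem x hx _ (hnorm θ)))
    ((hcc.norm.mul continuous_const).intervalIntegrable _ _)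
    (Eventually.of_forall fun θ _ x hx => by
      have h1 := (hdiff _ (hmem x hx _ (hnorm θ))).hasFDerivAt
      exact ((h1.comp x ((hasFDerivAt_id x).add_const _)).const_smul (c θ)))
  refine (hint.differentiableAt.const_mul (2 * Real.pi * Complex.I : ℂ)⁻¹).congr_of_eventuallyEq ?_
  filter_upwards [Metric.ball_mem_nhds x₀ hρ0] with x hx using key x hx

theorem contDiffOn_complex_of_differentiableOn {f : E → ℂ} {U : Set E} (hf : DifferentiableOn ℂ f U)
    (hU : IsOpen U) : ContDiffOn ℂ ∞ f U := by
  refine contDiffOn_infty.mpr fun n => ?_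
  induction n generalizing f with
  | zero => exact contDiffOn_zero.mpr hf.continuousOn
  | succ n ih =>
    push_cast
    rw [contDiffOn_succ_iff_fderiv_of_isOpen hU]
    refine ⟨hf, by simp, contDiffOn_clm_apply.mpr fun v => ih (differentiableOn_fderiv_apply_complex hf hU v)⟩

theorem contDiffAt_of_eventually_differentiableAt {f : E → ℂ} {x : E}
    (hf : ∀ᶠ y in 𝓝 x, DifferentiableAt ℂ f y) : ContDiffAt ℂ ∞ f x := by
  obtain ⟨U, hU, hUo, hx⟩ := eventually_nhds_iff.mp hf
  exact (contDiffOn_complex_of_differentiableOn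
    (fun y hy => (hU y hy).differentiableWithinAt) hUo).contDiffAt (hUo.mem_nhds hx)

end HolomorphicSmooth

/-! ### Smooth dependence of integrals on parameters. -/

section ParametricIntegral

variable {E F : Type*} [NormedAddCommGroup E] [NormedSpace ℝ E]
  [NormedAddCommGroup F] [NormedSpace ℝ F]

/-- By compactness of `{y₀} × [0, 1]` and the tube lemma, one bound `M + 1` on the derivative serves
all `y` near `y₀`, which gives domination. -/
theorem hasFDerivAt_intervalIntegral_of_contDiffOn {k : E × ℝ → F} {O : Set (E × ℝ)} (hO : IsOpen O)
    (hk : ContDiffOn ℝ 1 k O) {y₀ : E} (hy₀ : {y₀} ×ˢ Icc (0 : ℝ) 1 ⊆ O) :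
    HasFDerivAt (fun y => ∫ t in (0 : ℝ)..1, k (y, t))
      (∫ t in (0 : ℝ)..1, (fderiv ℝ k (y₀, t)).comp (ContinuousLinearMap.inl ℝ E ℝ)) y₀ := by
  have hD : ContinuousOn (fderiv ℝ k) O := hk.continuousOn_fderiv_of_isOpen hO le_rfl
  obtain ⟨M, hM⟩ := (isCompact_singleton.prod isCompact_Icc).exists_bound_of_continuousOn
    (hD.mono hy₀)
  have hO' : IsOpen (O ∩ (fun p => ‖fderiv ℝ k p‖) ⁻¹' Iio (M + 1)) :=
    hD.norm.isOpen_inter_preimage hO isOpen_Iio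
  obtain ⟨u, v, hu, hv, hyu, hIv, huv⟩ := generalized_tube_lemma (isCompact_singleton (x := y₀))
    (isCompact_Icc (a := (0 : ℝ)) (b := 1)) hO'
    (fun p hp => ⟨hy₀ hp, lt_of_le_of_lt (hM p hp) (by simp)⟩)
  have hu' : u ∈ 𝓝 y₀ := hu.mem_nhds (hyu rfl)
  have hI : uIoc (0 : ℝ) 1 ⊆ Icc 0 1 := by
    rw [uIoc_of_le zero_le_one]; exact Ioc_subset_Icc_self
  have hmem : ∀ y ∈ u, ∀ t ∈ Icc (0 : ℝ) 1,
      (y, t) ∈ O ∩ (fun p => ‖fderiv ℝ k p‖) ⁻¹' Iio (M + 1) := fun y hy t ht =>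
    huv ⟨hy, hIv ht⟩
  have hcont : ∀ y ∈ u, ContinuousOn (fun t : ℝ => k (y, t)) (Icc 0 1) := fun y hy =>
    hk.continuousOn.comp (by fun_prop) fun t ht => (hmem y hy t ht).1
  refine intervalIntegral.hasFDerivAt_integral_of_dominated_of_fderiv_le (𝕜 := ℝ)
    (F := fun y t => k (y, t))
    (F' := fun y t => (fderiv ℝ k (y, t)).comp (ContinuousLinearMap.inl ℝ E ℝ))
    (bound := fun _ => (M + 1) * ‖ContinuousLinearMap.inl ℝ E ℝ‖) hu' ?_ ?_ ?_ ?_ ?_ ?_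
  · filter_upwards [hu'] with y hy
    exact ((hcont y hy).mono hI).aestronglyMeasurable measurableSet_uIoc
  · exact ContinuousOn.intervalIntegrable (by
      rw [uIcc_of_le zero_le_one]; exact hcont y₀ (hyu rfl))
  · refine ContinuousOn.aestronglyMeasurable ?_ measurableSet_uIoc
    refine ContinuousOn.clm_comp ?_ continuousOn_const
    exact hD.comp (by fun_prop) fun t ht => (hmem y₀ (hyu rfl) t (hI ht)).1
  · refine Eventually.of_forall fun t ht y hy => ?_
    refine (ContinuousLinearMap.opNorm_comp_le _ _).trans ?_
    gcongr
    exact (hmem y hy t (hI ht)).2.le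
  · exact intervalIntegrable_const
  · refine Eventually.of_forall fun t ht y hy => ?_
    have h1 := ((hk.contDiffAt (hO.mem_nhds (hmem y hy t (hI ht)).1)).differentiableAt
      one_ne_zero).hasFDerivAt
    exact h1.comp y (hasFDerivAt_prodMk_left y t)

theorem contDiffOn_intervalIntegral_nat [CompleteSpace F] [FiniteDimensional ℝ E] (n : ℕ) {k : E × ℝ → F}
    {O : Set (E × ℝ)}
    (hO : IsOpen O) (hk : ContDiffOn ℝ ∞ k O) {U : Set E} (hU : IsOpen U)
    (hUO : U ×ˢ Icc (0 : ℝ) 1 ⊆ O) :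
    ContDiffOn ℝ n (fun y => ∫ t in (0 : ℝ)..1, k (y, t)) U := by
  have hd : ∀ {k : E × ℝ → F}, ContDiffOn ℝ ∞ k O → ∀ y ∈ U, HasFDerivAt
      (fun y => ∫ t in (0 : ℝ)..1, k (y, t))
      (∫ t in (0 : ℝ)..1, (fderiv ℝ k (y, t)).comp (ContinuousLinearMap.inl ℝ E ℝ)) y :=
    fun hk y hy => hasFDerivAt_intervalIntegral_of_contDiffOn hO (hk.of_le (by simp))
      fun p hp => hUO ⟨by rw [hp.1]; exact hy, hp.2⟩
  induction n generalizing k with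
  | zero =>
    exact contDiffOn_zero.mpr fun y hy => (hd hk y hy).continuousAt.continuousWithinAt
  | succ n ih =>
    push_cast
    rw [contDiffOn_succ_iff_fderiv_of_isOpen hU]
    refine ⟨fun y hy => (hd hk y hy).differentiableAt.differentiableWithinAt, by simp,
      contDiffOn_clm_apply.mpr fun v => ?_⟩
    have h1 : ContDiffOn ℝ ∞ (fun p => fderiv ℝ k p (v, 0)) O :=
      (hk.fderiv_of_isOpen hO (by simp)).clm_apply contDiffOn_const
    refine (ih h1).congr fun y hy => ?_
    have hy' : ContinuousOn (fun t => (fderiv ℝ k (y, t)).comp (ContinuousLinearMap.inl ℝ E ℝ))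
        (uIcc 0 1) := by
      refine ContinuousOn.clm_comp ?_ continuousOn_const
      refine (hk.continuousOn_fderiv_of_isOpen hO (by simp)).comp (by fun_prop) fun t ht => ?_
      rw [uIcc_of_le zero_le_one] at ht
      exact hUO ⟨hy, ht⟩
    rw [(hd hk y hy).fderiv, ContinuousLinearMap.intervalIntegral_apply hy'.intervalIntegrable]
    simp

theorem contDiffOn_intervalIntegral [CompleteSpace F] [FiniteDimensional ℝ E] {k : E × ℝ → F} {O : Set (E × ℝ)}
    (hO : IsOpen O) (hk : ContDiffOn ℝ ∞ k O) {U : Set E} (hU : IsOpen U)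
    (hUO : U ×ˢ Icc (0 : ℝ) 1 ⊆ O) :
    ContDiffOn ℝ ∞ (fun y => ∫ t in (0 : ℝ)..1, k (y, t)) U :=
  contDiffOn_infty.mpr fun n => contDiffOn_intervalIntegral_nat n hO hk hU hUO

end ParametricIntegral

/-! ### Hadamard division, and Cauchy–Riemann equations for the quotient. -/

section Division

variable {E : Type*} [NormedAddCommGroup E] [NormedSpace ℝ E]

/-- Hadamard's lemma: a smooth function vanishing where the linear function `m (y - y₀)` vanishes is
divisible by it, provided its derivative along the range of `P` is a multiple of `m`. -/
theorem exists_contDiffAt_eq_mul [FiniteDimensional ℝ E] {G : E → ℂ} {y₀ : E} (P : E →L[ℝ] E)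
    (m : E →L[ℝ] ℂ) (e : E)
    (hG : ∀ᶠ y in 𝓝 y₀, ContDiffAt ℝ ∞ G y)
    (hP : ∀ᶠ y in 𝓝 y₀, ∀ v, fderiv ℝ G y (P v) = m v * fderiv ℝ G y e)
    (hm : ∀ v, m (P v) = m v) (hG0 : ∀ᶠ y in 𝓝 y₀, m (y - y₀) = 0 → G y = 0) :
    ∃ Q : E → ℂ, (∀ᶠ y in 𝓝 y₀, ContDiffAt ℝ ∞ Q y) ∧ ∀ᶠ y in 𝓝 y₀, G y = m (y - y₀) * Q y := by
  obtain ⟨S, hS, hSo, hyS⟩ := eventually_nhds_iff.mp (hG.and (hP.and hG0))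
  -- The segment ends at `y` for `t = 1` and starts, for `t = 0`, at `y - P (y - y₀)`, where `m (· -
  -- y₀)` vanishes because `m ∘ P = m`. Integrating the derivative of `G` along it brings out the
  -- factor `m (y - y₀)`.
  set T : E × ℝ → E := fun p => p.1 - (1 - p.2) • P (p.1 - y₀) with hT
  have hTc : ContDiff ℝ ∞ T := by fun_prop
  have hO : IsOpen (T ⁻¹' S) := hSo.preimage hTc.continuous
  obtain ⟨U, I, hU, hI, hyU, hII, hUI⟩ := generalized_tube_lemma (isCompact_singleton (x := y₀))
    (isCompact_Icc (a := (0 : ℝ)) (b := 1)) hO (by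
      rintro ⟨y, t⟩ ⟨hy, ht⟩
      obtain rfl : y = y₀ := hy
      simpa [hT] using hyS)
  have hUO : U ×ˢ Icc (0 : ℝ) 1 ⊆ T ⁻¹' S := (prod_mono le_rfl hII).trans hUI
  have hGS : ContDiffOn ℝ ∞ G S := fun y hy => (hS y hy).1.contDiffWithinAt
  have hk : ContDiffOn ℝ ∞ (fun p => fderiv ℝ G (T p) e) (T ⁻¹' S) :=
    ((hGS.fderiv_of_isOpen hSo (by simp)).clm_apply contDiffOn_const).comp hTc.contDiffOn
      fun p hp => hp
  have hQ := contDiffOn_intervalIntegral hO hk hU hUO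
  refine ⟨fun y => ∫ t in (0 : ℝ)..1, fderiv ℝ G (T (y, t)) e, ?_, ?_⟩
  rotate_left
  · filter_upwards [hU.mem_nhds (hyU rfl)] with y hy
    have hd : ∀ t ∈ uIcc (0 : ℝ) 1, HasDerivAt (fun t => G (T (y, t)))
        (m (y - y₀) * fderiv ℝ G (T (y, t)) e) t := by
      intro t ht
      rw [uIcc_of_le zero_le_one] at ht
      have hmem : T (y, t) ∈ S := hUO ⟨hy, ht⟩
      have h1 := ((hS _ hmem).1.differentiableAt (by simp)).hasFDerivAt
      have h2 : HasDerivAt (fun t : ℝ => T (y, t)) (P (y - y₀)) t := by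
        have := (((hasDerivAt_id t).const_sub 1).smul_const (P (y - y₀))).const_sub y
        simpa [hT] using this
      have h3 := h1.comp_hasDerivAt t h2
      rwa [(hS _ hmem).2.1] at h3
    have hcont : ContinuousOn (fun t => m (y - y₀) * fderiv ℝ G (T (y, t)) e) (uIcc 0 1) := by
      rw [uIcc_of_le zero_le_one]
      exact continuousOn_const.mul (hk.continuousOn.comp (f := fun t : ℝ => (y, t)) (by fun_prop)
        fun t ht => hUO ⟨hy, ht⟩)
    have h := intervalIntegral.integral_eq_sub_of_hasDerivAt hd hcont.intervalIntegrable
    rw [intervalIntegral.integral_const_mul] at h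
    have h0 : T (y, 0) ∈ S := hUO ⟨hy, by simp⟩
    have hG0' : G (T (y, 0)) = 0 := by
      apply (hS _ h0).2.2
      simp only [hT, sub_zero, one_smul]
      rw [sub_right_comm, map_sub, hm, sub_self]
    rw [hG0', sub_zero] at h
    rw [h]
    simp [hT]
  · filter_upwards [hU.mem_nhds (hyU rfl)] with y hy using hQ.contDiffAt (hU.mem_nhds hy)

/-- Where the divisor is nonzero, the equations for `Q` follow from those for `G` by Leibniz and
cancellation. They extend to the zero set by continuity, approaching along `y + t • e`, where the
divisor equals `t`. The set `S` of pairs of directions covers both full holomorphy and holomorphy in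
the leaf variable only. -/
theorem eventually_fderiv_quotient {G Q : E → ℂ} {y₀ : E} (m : E →L[ℝ] ℂ) {e : E} (he : m e = 1)
    (S : Set (E × E)) (hS : ∀ p ∈ S, m p.2 = Complex.I * m p.1)
    (hQ : ∀ᶠ y in 𝓝 y₀, ContDiffAt ℝ ∞ Q y) (hGQ : ∀ᶠ y in 𝓝 y₀, G y = m (y - y₀) * Q y)
    (hG : ∀ᶠ y in 𝓝 y₀, ∀ p ∈ S, fderiv ℝ G y p.2 = Complex.I * fderiv ℝ G y p.1) :
    ∀ᶠ y in 𝓝 y₀, ∀ p ∈ S, fderiv ℝ Q y p.2 = Complex.I * fderiv ℝ Q y p.1 := by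
  have hoff : ∀ᶠ y in 𝓝 y₀, m (y - y₀) ≠ 0 →
      ∀ p ∈ S, fderiv ℝ Q y p.2 - Complex.I * fderiv ℝ Q y p.1 = 0 := by
    filter_upwards [hQ, hGQ.eventually_nhds, hG] with y h1 h2 h3 hy p hp
    have h4 : fderiv ℝ G y = m (y - y₀) • fderiv ℝ Q y + Q y • m := by
      rw [EventuallyEq.fderiv_eq h2]
      have hm : HasFDerivAt (fun y => m (y - y₀)) m y := by
        have := m.hasFDerivAt.comp (x := y) ((hasFDerivAt_id y).sub_const y₀)
        rwa [ContinuousLinearMap.comp_id] at this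
      exact (hm.mul (h1.differentiableAt (by simp)).hasFDerivAt).fderiv
    have h5 := h3 p hp
    rw [h4] at h5
    simp only [add_apply, smul_apply, smul_eq_mul, hS p hp] at h5
    refine (mul_eq_zero.mp (?_ : m (y - y₀) * _ = 0)).resolve_left hy
    linear_combination h5
  filter_upwards [hQ, hoff.eventually_nhds, hoff] with y h1 h2 h3 p hp
  by_cases hy : m (y - y₀) = 0
  swap
  · exact sub_eq_zero.mp (h3 hy p hp)
  have hc : ContinuousAt (fun y => fderiv ℝ Q y p.2 - Complex.I * fderiv ℝ Q y p.1) y := by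
    have := (h1.fderiv_right (m := 0) (by simp)).continuousAt
    fun_prop
  have hl : Tendsto (fun t : ℝ => y + t • e) (𝓝[≠] 0) (𝓝 y) := by
    have : Continuous fun t : ℝ => y + t • e := by fun_prop
    simpa using (this.tendsto 0).mono_left nhdsWithin_le_nhds
  have hz : ∀ᶠ t : ℝ in 𝓝[≠] 0,
      fderiv ℝ Q (y + t • e) p.2 - Complex.I * fderiv ℝ Q (y + t • e) p.1 = 0 := by
    filter_upwards [hl.eventually h2, self_mem_nhdsWithin] with t ht ht0
    refine ht ?_ p hp
    rw [add_sub_right_comm, map_add, hy, map_smul, he]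
    simpa using ht0
  exact sub_eq_zero.mp (tendsto_nhds_unique (hc.tendsto.comp hl)
    (tendsto_const_nhds.congr' (hz.mono fun t ht => ht.symm)))

end Division

/-! ### Real versus complex differentiability. -/

section ComplexLinear

variable {V F : Type*} [NormedAddCommGroup V] [NormedSpace ℂ V] [NormedSpace ℝ V]
  [IsScalarTower ℝ ℂ V] [NormedAddCommGroup F] [NormedSpace ℂ F] [NormedSpace ℝ F]
  [IsScalarTower ℝ ℂ F]

/-- A real linear map commuting with multiplication by `I` is complex linear. -/
def ContinuousLinearMap.complexLinearOfReal (L : V →L[ℝ] F)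
    (hL : ∀ v, L (Complex.I • v) = Complex.I • L v) : V →L[ℂ] F where
  toFun := L
  map_add' := L.map_add
  map_smul' c v := by
    have h : ∀ (r : ℝ) (x : V), (r : ℂ) • x = r • x := fun r x => by
      rw [← smul_one_smul ℂ r x, Complex.real_smul, mul_one]
    have h' : ∀ (r : ℝ) (x : F), (r : ℂ) • x = r • x := fun r x => by
      rw [← smul_one_smul ℂ r x, Complex.real_smul, mul_one]
    obtain ⟨a, b⟩ := c
    rw [Complex.mk_eq_add_mul_I, add_smul, mul_smul, L.map_add, h, h, L.map_smul, L.map_smul, hL]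
    simp only [RingHom.id_apply, add_smul, mul_smul, h']
  cont := L.continuous

theorem differentiableAt_complex_of_real {f : V → F} {x : V} (hf : DifferentiableAt ℝ f x)
    (h : ∀ v, fderiv ℝ f x (Complex.I • v) = Complex.I • fderiv ℝ f x v) :
    DifferentiableAt ℂ f x :=
  (hasFDerivAt_of_restrictScalars ℝ (f' := (fderiv ℝ f x).complexLinearOfReal h) hf.hasFDerivAt
    rfl).differentiableAt

theorem fderiv_real_eq_complex {f : V → F} {x : V} (hf : DifferentiableAt ℂ f x) (v : V) :
    fderiv ℝ f x v = fderiv ℂ f x v := by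
  rw [hf.fderiv_restrictScalars ℝ]; rfl

theorem fderiv_real_I_smul {f : V → F} {x : V} (hf : DifferentiableAt ℂ f x) (v : V) :
    fderiv ℝ f x (Complex.I • v) = Complex.I • fderiv ℝ f x v := by
  rw [fderiv_real_eq_complex hf, fderiv_real_eq_complex hf, map_smul]

end ComplexLinear

/-! ### Smooth functions that are holomorphic along the leaves. -/

section LeafwiseHolomorphic

variable {V F : Type*} [NormedAddCommGroup V] [NormedSpace ℂ V] [NormedSpace ℝ V]
  [NormedAddCommGroup F] [NormedSpace ℂ F] [NormedSpace ℝ F]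

/-- `r` is smooth near `q`, and holomorphic in the first variable. -/
def LeafwiseHolomorphicAt (r : V × ℝ → F) (q : V × ℝ) : Prop :=
  ∀ᶠ p in 𝓝 q, ContDiffAt ℝ ∞ r p ∧
    ∀ v : V, fderiv ℝ r p (Complex.I • v, 0) = Complex.I • fderiv ℝ r p (v, 0)

namespace LeafwiseHolomorphicAt

theorem const (c : F) (q : V × ℝ) : LeafwiseHolomorphicAt (fun _ => c) q :=
  Eventually.of_forall fun p => ⟨contDiffAt_const, by simp⟩

theorem congr {r s : V × ℝ → F} {q : V × ℝ} (hr : LeafwiseHolomorphicAt r q)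
    (h : r =ᶠ[𝓝 q] s) : LeafwiseHolomorphicAt s q := by
  filter_upwards [hr, h.eventually_nhds] with p hp h'
  replace h' : r =ᶠ[𝓝 p] s := h'
  exact ⟨hp.1.congr_of_eventuallyEq h'.symm, by rw [← h'.fderiv_eq]; exact hp.2⟩

theorem continuousAt {r : V × ℝ → F} {q : V × ℝ} (hr : LeafwiseHolomorphicAt r q) :
    ContinuousAt r q := hr.self_of_nhds.1.continuousAt

theorem sub {r s : V × ℝ → F} {q : V × ℝ} (hr : LeafwiseHolomorphicAt r q)
    (hs : LeafwiseHolomorphicAt s q) : LeafwiseHolomorphicAt (fun p => r p - s p) q := by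
  filter_upwards [hr, hs] with p h1 h2
  refine ⟨h1.1.sub h2.1, fun v => ?_⟩
  rw [fderiv_fun_sub (h1.1.differentiableAt (by simp)) (h2.1.differentiableAt (by simp))]
  simp [h1.2, h2.2, smul_sub]

theorem mul {r s : V × ℝ → ℂ} {q : V × ℝ} (hr : LeafwiseHolomorphicAt r q)
    (hs : LeafwiseHolomorphicAt s q) : LeafwiseHolomorphicAt (fun p => r p * s p) q := by
  filter_upwards [hr, hs] with p h1 h2
  refine ⟨h1.1.mul h2.1, fun v => ?_⟩
  rw [fderiv_fun_mul (h1.1.differentiableAt (by simp)) (h2.1.differentiableAt (by simp))]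
  simp only [add_apply, smul_apply, smul_eq_mul, h1.2, h2.2]
  ring

theorem pow {r : V × ℝ → ℂ} {q : V × ℝ} (hr : LeafwiseHolomorphicAt r q) (k : ℕ) :
    LeafwiseHolomorphicAt (fun p => r p ^ k) q := by
  induction k with
  | zero => simpa using const (1 : ℂ) q
  | succ k ih => simpa only [pow_succ] using ih.mul hr

/-- Hadamard division by the transverse coordinate. That coordinate is constant in the leaf
directions, so the quotient remains holomorphic along the leaves. -/
theorem exists_eq_mul [FiniteDimensional ℝ V] {r : V × ℝ → ℂ} {z : V} {u : ℝ}
    (hr : LeafwiseHolomorphicAt r (z, u)) (h0 : ∀ᶠ x in 𝓝 z, r (x, u) = 0) :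
    ∃ ρ : V × ℝ → ℂ, LeafwiseHolomorphicAt ρ (z, u) ∧
      ∀ᶠ p in 𝓝 (z, u), r p = ((p.2 - u : ℝ) : ℂ) * ρ p := by
  set m : V × ℝ →L[ℝ] ℂ := Complex.ofRealCLM.comp (ContinuousLinearMap.snd ℝ V ℝ) with hm
  set P : V × ℝ →L[ℝ] V × ℝ :=
    (ContinuousLinearMap.inr ℝ V ℝ).comp (ContinuousLinearMap.snd ℝ V ℝ) with hP
  obtain ⟨Q, hQ, hrQ⟩ := exists_contDiffAt_eq_mul (G := r) (y₀ := (z, u)) P m (0, 1)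
    (hr.mono fun p h => h.1) (Eventually.of_forall fun p v => by
      have : P v = v.2 • ((0 : V), (1 : ℝ)) := by simp [hP]
      rw [this, map_smul]
      simp [hm]) (fun v => by simp [hP, hm]) (by
      have h1 : Tendsto Prod.fst (𝓝 (z, u)) (𝓝 z) := continuous_fst.tendsto _
      filter_upwards [h1.eventually h0] with p hp hmp
      have : p.2 = u := by
        have : ((p.2 - u : ℝ) : ℂ) = 0 := by simpa [hm] using hmp
        exact sub_eq_zero.mp (by exact_mod_cast this)
      rw [← hp, ← this])
  refine ⟨Q, ?_, ?_⟩
  · have h2 := eventually_fderiv_quotient m (e := ((0 : V), (1 : ℝ))) (by simp [hm])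
      {p | ∃ v : V, p = ((v, 0), (Complex.I • v, 0))} (by rintro _ ⟨v, rfl⟩; simp [hm]) hQ hrQ
      (hr.mono fun p hp => by rintro _ ⟨v, rfl⟩; exact hp.2 v)
    filter_upwards [hQ, h2] with p h3 h4
    exact ⟨h3, fun v => h4 _ ⟨v, rfl⟩⟩
  · filter_upwards [hrQ] with p hp
    simpa [hm] using hp

variable [IsScalarTower ℝ ℂ F]

theorem holomorphic_comp [FiniteDimensional ℂ F] {ψ : V × ℝ → F} {q : V × ℝ}
    (hψ : LeafwiseHolomorphicAt ψ q)
    {G : F → ℂ} (hG : ∀ᶠ e in 𝓝 (ψ q), DifferentiableAt ℂ G e) :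
    LeafwiseHolomorphicAt (fun p => G (ψ p)) q := by
  filter_upwards [hψ, hψ.continuousAt.eventually hG.eventually_nhds] with p h1 h2
  have h3 : ContDiffAt ℝ ∞ G (ψ p) := (contDiffAt_of_eventually_differentiableAt h2).restrict_scalars ℝ
  refine ⟨h3.comp p h1.1, fun v => ?_⟩
  rw [fderiv_fun_comp p (h3.differentiableAt (by simp)) (h1.1.differentiableAt (by simp))]
  simp only [ContinuousLinearMap.comp_apply, h1.2]
  exact fderiv_real_I_smul h2.self_of_nhds _

variable [IsScalarTower ℝ ℂ V]

theorem slice {r : V × ℝ → F} {z : V} {u : ℝ} (hr : LeafwiseHolomorphicAt r (z, u)) :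
    ∀ᶠ x in 𝓝 z, DifferentiableAt ℂ (fun x => r (x, u)) x := by
  have hc : ContinuousAt (fun x : V => (x, u)) z := by fun_prop
  filter_upwards [hc.eventually hr] with x hx
  have h1 := HasFDerivAt.comp (𝕜 := ℝ) (f := fun x : V => (x, u)) x
    (hx.1.differentiableAt (by simp)).hasFDerivAt (hasFDerivAt_prodMk_left x u)
  refine differentiableAt_complex_of_real h1.differentiableAt fun v => ?_
  have h2 : fderiv ℝ (fun x => r (x, u)) x = _ := h1.fderiv
  rw [h2]
  simpa using hx.2 v

end LeafwiseHolomorphicAt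

end LeafwiseHolomorphic

/-! ### The holomorphic inverse function theorem. -/

section HolomorphicInverse

variable {E F : Type*} [NormedAddCommGroup E] [NormedSpace ℂ E] [FiniteDimensional ℂ E]
  [NormedAddCommGroup F] [NormedSpace ℂ F] [FiniteDimensional ℂ F]

theorem contDiffAt_of_eventually_differentiableAt_finiteDimensional {f : E → F} {x : E}
    (hf : ∀ᶠ y in 𝓝 x, DifferentiableAt ℂ f y) : ContDiffAt ℂ ∞ f x := by
  let e : F ≃L[ℂ] (Fin (Module.finrank ℂ F) → ℂ) :=
    ContinuousLinearEquiv.ofFinrankEq (Module.finrank_fin_fun ℂ).symm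
  rw [← e.comp_contDiffAt_iff, contDiffAt_pi]
  intro i
  apply contDiffAt_of_eventually_differentiableAt
  filter_upwards [hf] with y hy
  exact (differentiableAt_pi.mp (e.differentiableAt.comp y hy)) i

theorem exists_holomorphic_local_inverse {f : E → F} {x : E}
    (hf : ∀ᶠ y in 𝓝 x, DifferentiableAt ℂ f y) (f' : E ≃L[ℂ] F)
    (hf' : HasFDerivAt f (f' : E →L[ℂ] F) x) :
    ∃ g : F → E, (∀ᶠ y in 𝓝 (f x), DifferentiableAt ℂ g y) ∧ g (f x) = x ∧
      (∀ᶠ y in 𝓝 x, g (f y) = y) ∧ ∀ᶠ y in 𝓝 (f x), f (g y) = y := by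
  have : CompleteSpace E := FiniteDimensional.complete ℂ E
  have hc : ContDiffAt ℂ 1 f x :=
    (contDiffAt_of_eventually_differentiableAt_finiteDimensional hf).of_le (by simp)
  have hs := hc.hasStrictFDerivAt' hf' one_ne_zero
  refine ⟨hc.localInverse hf' one_ne_zero, ?_, ?_, ?_, ?_⟩
  · filter_upwards [(hc.to_localInverse hf' one_ne_zero).eventually (by simp)] with y hy
    exact hy.differentiableAt (by simp)
  · exact hs.eventually_left_inverse.self_of_nhds
  · exact hs.eventually_left_inverse
  · exact hs.eventually_right_inverse

end HolomorphicInverse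

/-! ### Division of holomorphic functions by an equation of a hypersurface. -/

section HolomorphicDivision

variable {E : Type*} [NormedAddCommGroup E] [NormedSpace ℂ E] [NormedSpace ℝ E]
  [IsScalarTower ℝ ℂ E] [FiniteDimensional ℂ E] [FiniteDimensional ℝ E]

/-- A holomorphic function that vanishes on the zero set of `m (y - x)`, `m` a linear form, is
divisible by it. -/
theorem exists_holomorphic_eq_linear_mul (m : E →L[ℂ] ℂ) {e : E} (he : m e = 1) {x : E} {G : E → ℂ}
    (hG : ∀ᶠ y in 𝓝 x, DifferentiableAt ℂ G y) (h0 : ∀ᶠ y in 𝓝 x, m (y - x) = 0 → G y = 0) :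
    ∃ Q : E → ℂ, (∀ᶠ y in 𝓝 x, DifferentiableAt ℂ Q y) ∧ ∀ᶠ y in 𝓝 x, G y = m (y - x) * Q y := by
  have hsm : ∀ᶠ y in 𝓝 x, ContDiffAt ℝ ∞ G y := by
    filter_upwards [hG.eventually_nhds] with y hy
    exact (contDiffAt_of_eventually_differentiableAt hy).restrict_scalars ℝ
  -- Here `P v = m v • e`, and the required identity on `P v` is the complex linearity of the
  -- derivative of `G`.
  obtain ⟨Q, hQ, hGQ⟩ := exists_contDiffAt_eq_mul (G := G) (y₀ := x)
    ((m.smulRight e).restrictScalars ℝ) (m.restrictScalars ℝ) e hsm (by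
      filter_upwards [hG] with y hy v
      rw [fderiv_real_eq_complex hy, fderiv_real_eq_complex hy]
      simp) (by simp [he]) h0
  refine ⟨Q, ?_, hGQ⟩
  have h := eventually_fderiv_quotient (m.restrictScalars ℝ) (e := e) he
    {p | ∃ v : E, p = (v, Complex.I • v)} (by rintro _ ⟨v, rfl⟩; simp) hQ hGQ (by
      filter_upwards [hG] with y hy
      rintro _ ⟨v, rfl⟩
      exact fderiv_real_I_smul hy v)
  filter_upwards [hQ, h] with y h1 h2
  exact differentiableAt_complex_of_real (h1.differentiableAt (by simp)) fun v => h2 _ ⟨v, rfl⟩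

/-- A holomorphic function that vanishes on a smooth hypersurface is divisible by every defining
function of it. -/
theorem exists_holomorphic_eq_mul {w G : E → ℂ} {x : E}
    (hw : ∀ᶠ y in 𝓝 x, DifferentiableAt ℂ w y) (hwx : w x = 0) (hw' : fderiv ℂ w x ≠ 0)
    (hG : ∀ᶠ y in 𝓝 x, DifferentiableAt ℂ G y) (h0 : ∀ᶠ y in 𝓝 x, w y = 0 → G y = 0) :
    ∃ Q : E → ℂ, (∀ᶠ y in 𝓝 x, DifferentiableAt ℂ Q y) ∧ ∀ᶠ y in 𝓝 x, G y = w y * Q y := by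
  set m := fderiv ℂ w x with hm
  obtain ⟨e, he⟩ : ∃ e, m e = 1 := by
    obtain ⟨v, hv⟩ := DFunLike.exists_ne hw'
    replace hv : m v ≠ 0 := hv
    exact ⟨(m v)⁻¹ • v, by simp [hv]⟩
  -- `Θ` straightens the hypersurface: it is tangent to the identity at `x` and carries `w` to the
  -- linear form `m (· - x)`.
  set Θ : E → E := fun y => y + (w y - m (y - x)) • e with hΘ
  have hΘx : Θ x = x := by simp [hΘ, hwx]
  have hmΘ : ∀ y, m (Θ y - x) = w y := fun y => by
    have : Θ y - x = (y - x) + (w y - m (y - x)) • e := by simp only [hΘ]; abel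
    rw [this, map_add, map_smul, he]
    simp
  have hΘd : ∀ᶠ y in 𝓝 x, DifferentiableAt ℂ Θ y := by
    filter_upwards [hw] with y hy
    fun_prop
  have hΘ' : HasFDerivAt Θ ((ContinuousLinearEquiv.refl ℂ E : E ≃L[ℂ] E) : E →L[ℂ] E) x := by
    have h1 : HasFDerivAt (fun y => m (y - x)) m x := by
      have := m.hasFDerivAt.comp (x := x) ((hasFDerivAt_id x).sub_const x)
      rwa [ContinuousLinearMap.comp_id] at this
    have h2 := (hasFDerivAt_id x).add ((hw.self_of_nhds.hasFDerivAt.sub h1).smul_const e)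
    rw [← hm, sub_self] at h2
    refine HasFDerivAt.congr_fderiv (f := Θ) h2 ?_
    ext v
    change v + (0 : E →L[ℂ] ℂ) v • e = v
    simp
  obtain ⟨Ξ, hΞ, hΞx, hl, hr⟩ := exists_holomorphic_local_inverse hΘd _ hΘ'
  rw [hΘx] at hΞ hΞx hr
  have hΞt : Tendsto Ξ (𝓝 x) (𝓝 x) := by
    have := hΞ.self_of_nhds.continuousAt.tendsto
    rwa [hΞx] at this
  have hΘt : Tendsto Θ (𝓝 x) (𝓝 x) := by
    have := hΘd.self_of_nhds.continuousAt.tendsto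
    rwa [hΘx] at this
  obtain ⟨Q, hQ, hGQ⟩ := exists_holomorphic_eq_linear_mul m he (x := x) (G := fun y => G (Ξ y))
    (by filter_upwards [hΞ, hΞt.eventually hG] with y h1 h2 using h2.comp y h1)
    (by
      filter_upwards [hr, hΞt.eventually h0] with y h1 h2 h3
      refine h2 ?_
      rw [← hmΘ, h1, h3])
  refine ⟨fun y => Q (Θ y), ?_, ?_⟩
  · filter_upwards [hΘd, hΘt.eventually hQ] with y h1 h2 using h2.comp y h1
  · filter_upwards [hl, hΘt.eventually hGQ] with y h1 h2
    rw [h1, hmΘ] at h2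
    exact h2

end HolomorphicDivision

/-! ### Local model: jets along a leaf of a Levi-flat hypersurface. -/

section LocalModel

variable {V E : Type*} [NormedAddCommGroup V] [NormedSpace ℂ V] [NormedSpace ℝ V]
  [NormedAddCommGroup E] [NormedSpace ℂ E] [NormedSpace ℝ E]

/-- `ψ` parametrizes a Levi-flat hypersurface near `q`, and `w` is a defining function of the leaf
`{u = q.2}`. -/
structure IsLeafParametrization (ψ : V × ℝ → E) (w : E → ℂ) (q : V × ℝ) : Prop where
  leafwise : LeafwiseHolomorphicAt ψ q
  immersion : Function.Injective (fderiv ℝ ψ q)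
  finrank_eq : Module.finrank ℂ E = Module.finrank ℂ V + 1
  holomorphic : ∀ᶠ e in 𝓝 (ψ q), DifferentiableAt ℂ w e
  submersion : fderiv ℂ w (ψ q) ≠ 0
  vanishing : ∀ᶠ z in 𝓝 q.1, w (ψ (z, q.2)) = 0
  zeros : ∀ N ∈ 𝓝 q, ∀ᶠ e in 𝓝 (ψ q), w e = 0 → e ∈ ψ '' N

namespace IsLeafParametrization

variable {ψ : V × ℝ → E} {w : E → ℂ} {q : V × ℝ}

theorem map_eq_zero (h : IsLeafParametrization ψ w q) : w (ψ q) = 0 := h.vanishing.self_of_nhds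

variable [IsScalarTower ℝ ℂ V] [IsScalarTower ℝ ℂ E]

theorem hasFDerivAt_slice (h : IsLeafParametrization ψ w q) :
    HasFDerivAt (fun z => ψ (z, q.2)) (fderiv ℂ (fun z => ψ (z, q.2)) q.1) q.1 ∧
      ∀ v, fderiv ℂ (fun z => ψ (z, q.2)) q.1 v = fderiv ℝ ψ q (v, 0) := by
  have h1 : DifferentiableAt ℂ (fun z => ψ (z, q.2)) q.1 := h.leafwise.slice.self_of_nhds
  refine ⟨h1.hasFDerivAt, fun v => ?_⟩
  have h2 := HasFDerivAt.comp (𝕜 := ℝ) (f := fun x : V => (x, q.2)) q.1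
    (h.leafwise.self_of_nhds.1.differentiableAt (by simp)).hasFDerivAt
    (hasFDerivAt_prodMk_left q.1 q.2)
  have h3 : fderiv ℝ (fun z => ψ (z, q.2)) q.1 = _ := h2.fderiv
  rw [← fderiv_real_eq_complex h1, h3]
  simp

theorem slice_injective (h : IsLeafParametrization ψ w q) :
    Function.Injective (fderiv ℂ (fun z => ψ (z, q.2)) q.1) := by
  intro v v' hv
  rw [h.hasFDerivAt_slice.2, h.hasFDerivAt_slice.2] at hv
  simpa using h.immersion hv

variable [FiniteDimensional ℂ E]

/-- By a dimension count the kernel of `dw` is exactly the complex tangent space of the leaf. A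
transverse vector in it would be the image of a leaf direction, against the injectivity of the real
derivative of `ψ`. -/
theorem fderiv_transverse_ne_zero (h : IsLeafParametrization ψ w q) :
    fderiv ℂ w (ψ q) (fderiv ℝ ψ q (0, 1)) ≠ 0 := by
  intro h0
  set A := fderiv ℂ (fun z => ψ (z, q.2)) q.1 with hA
  set m := fderiv ℂ w (ψ q) with hm
  have hcomp : m.comp A = 0 := by
    have h1 : HasFDerivAt (fun z => w (ψ (z, q.2))) (m.comp A) q.1 :=
      HasFDerivAt.comp (f := fun z => ψ (z, q.2)) q.1 h.holomorphic.self_of_nhds.hasFDerivAt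
        h.hasFDerivAt_slice.1
    have h2 : HasFDerivAt (fun z => w (ψ (z, q.2))) (0 : V →L[ℂ] ℂ) q.1 :=
      (hasFDerivAt_const (0 : ℂ) q.1).congr_of_eventuallyEq h.vanishing
    exact h1.unique h2
  have hle : (A : V →ₗ[ℂ] E).range ≤ (m : E →ₗ[ℂ] ℂ).ker := by
    rintro _ ⟨v, rfl⟩
    exact DFunLike.congr_fun hcomp v
  have hrange : Module.finrank ℂ (A : V →ₗ[ℂ] E).range = Module.finrank ℂ V :=
    LinearMap.finrank_range_of_inj h.slice_injective
  have hker : Module.finrank ℂ (m : E →ₗ[ℂ] ℂ).ker = Module.finrank ℂ V := by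
    have h1 := LinearMap.finrank_range_add_finrank_ker (m : E →ₗ[ℂ] ℂ)
    have hne : (m : E →ₗ[ℂ] ℂ) ≠ 0 := fun h2 => h.submersion (by
      ext v; exact DFunLike.congr_fun h2 v)
    rw [LinearMap.range_eq_top.mpr (LinearMap.surjective hne), finrank_top, h.finrank_eq,
      Module.finrank_self] at h1
    omega
  have heq := Submodule.eq_of_le_of_finrank_eq hle (hrange.trans hker.symm)
  have hmem : fderiv ℝ ψ q (0, 1) ∈ (A : V →ₗ[ℂ] E).range := by
    rw [heq]; exact h0
  obtain ⟨v, hv⟩ := hmem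
  replace hv : A v = fderiv ℝ ψ q (0, 1) := hv
  rw [hA, h.hasFDerivAt_slice.2] at hv
  simpa using h.immersion hv

/-- This makes `w` and `u - u₀` interchangeable on `M`. The value of `v` at `q` is the transverse
derivative of `w ∘ ψ`, hence nonzero. -/
theorem exists_factor [FiniteDimensional ℝ V] (h : IsLeafParametrization ψ w q) :
    ∃ v : V × ℝ → ℂ, LeafwiseHolomorphicAt v q ∧ v q ≠ 0 ∧
      ∀ᶠ p in 𝓝 q, w (ψ p) = ((p.2 - q.2 : ℝ) : ℂ) * v p := by
  have h1 := h.leafwise.holomorphic_comp h.holomorphic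
  obtain ⟨v, hv, hv'⟩ := h1.exists_eq_mul h.vanishing
  refine ⟨v, hv, ?_, hv'⟩
  have h2 : fderiv ℝ (fun p => w (ψ p)) q (0, 1) = fderiv ℂ w (ψ q) (fderiv ℝ ψ q (0, 1)) := by
    rw [fderiv_fun_comp q (h.holomorphic.self_of_nhds.restrictScalars ℝ)
      (h.leafwise.self_of_nhds.1.differentiableAt (by simp))]
    exact fderiv_real_eq_complex h.holomorphic.self_of_nhds _
  have h3 : HasFDerivAt (fun p : V × ℝ => ((p.2 - q.2 : ℝ) : ℂ))
      (Complex.ofRealCLM.comp (ContinuousLinearMap.snd ℝ V ℝ)) q :=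
    Complex.ofRealCLM.hasFDerivAt.comp q (hasFDerivAt_snd.sub_const q.2)
  have h4 := (h3.mul (hv.self_of_nhds.1.differentiableAt (by simp)).hasFDerivAt).fderiv
  have h5 : fderiv ℝ (fun p => w (ψ p)) q = _ := (EventuallyEq.fderiv_eq hv').trans h4
  intro h6
  apply h.fderiv_transverse_ne_zero
  rw [← h2, h5, h6]
  simp

/-- Induction on the order. After extracting `w^k`, the cofactor `Q` is still `O(|w|)` on `M` off
the leaf; by continuity it vanishes on the leaf, so another factor `w` comes out. -/
theorem exists_eq_pow_mul [FiniteDimensional ℝ V] [FiniteDimensional ℝ E]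
    (h : IsLeafParametrization ψ w q) (k : ℕ) {G : E → ℂ}
    (hG : ∀ᶠ e in 𝓝 (ψ q), DifferentiableAt ℂ G e) {C : ℝ}
    (hC : ∀ᶠ p in 𝓝 q, ‖G (ψ p)‖ ≤ C * ‖w (ψ p)‖ ^ k) :
    ∃ Q : E → ℂ, (∀ᶠ e in 𝓝 (ψ q), DifferentiableAt ℂ Q e) ∧
      ∀ᶠ e in 𝓝 (ψ q), G e = w e ^ k * Q e := by
  induction k generalizing C with
  | zero => exact ⟨G, hG, Eventually.of_forall fun e => by simp⟩
  | succ k ih =>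
    obtain ⟨v, hv, hvq, hwv⟩ := h.exists_factor
    have hψ := h.leafwise.continuousAt
    have hw1 : ∀ᶠ p in 𝓝 q, ‖w (ψ p)‖ < 1 := by
      have := (h.leafwise.holomorphic_comp h.holomorphic).continuousAt.norm
      exact this.eventually_lt_const (by simp [h.map_eq_zero])
    obtain ⟨Q, hQ, hGQ⟩ := ih (C := |C|) (by
      filter_upwards [hC, hw1] with p h1 h2
      calc ‖G (ψ p)‖ ≤ C * ‖w (ψ p)‖ ^ (k + 1) := h1
        _ ≤ |C| * ‖w (ψ p)‖ ^ (k + 1) := by gcongr; exact le_abs_self C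
        _ ≤ |C| * ‖w (ψ p)‖ ^ k := by
          gcongr ?_ * ?_
          exact pow_le_pow_of_le_one (norm_nonneg _) h2.le (Nat.le_succ k))
    have hoff : ∀ᶠ p in 𝓝 q, w (ψ p) ≠ 0 → ‖Q (ψ p)‖ ≤ C * ‖w (ψ p)‖ := by
      filter_upwards [hC, hψ.eventually hGQ] with p h1 h2 h3
      rw [h2, norm_mul, norm_pow, pow_succ, mul_comm, ← mul_assoc, mul_right_comm] at h1
      exact le_of_mul_le_mul_right h1 (pow_pos (norm_pos_iff.mpr h3) k)
    have hon : ∀ᶠ p in 𝓝 q, w (ψ p) = 0 → Q (ψ p) = 0 := by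
      filter_upwards [hoff.eventually_nhds, hwv, hwv.eventually_nhds,
        (hv.continuousAt.eventually_ne hvq).eventually_nhds, h.leafwise,
        hψ.eventually hQ, hψ.eventually h.holomorphic] with p h1 h2 h3 h4 h5 h6 h7 h8
      have hp2 : p.2 = q.2 := by
        rw [h8] at h2
        have := (mul_eq_zero.mp h2.symm).resolve_right h4.self_of_nhds
        exact sub_eq_zero.mp (by exact_mod_cast this)
      -- The bound on `Q` is known only where `w ≠ 0`, so the point of the leaf is approached along
      -- the transversal.
      have hl : Tendsto (fun t : ℝ => (p.1, p.2 + t)) (𝓝[≠] 0) (𝓝 p) := by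
        have : Continuous fun t : ℝ => (p.1, p.2 + t) := by fun_prop
        simpa using (this.tendsto 0).mono_left nhdsWithin_le_nhds
      have hQt : Tendsto (fun t : ℝ => ‖Q (ψ (p.1, p.2 + t))‖) (𝓝[≠] 0) (𝓝 ‖Q (ψ p)‖) :=
        ((h6.continuousAt.comp h5.1.continuousAt).norm.tendsto.comp hl)
      have hwt : Tendsto (fun t : ℝ => C * ‖w (ψ (p.1, p.2 + t))‖) (𝓝[≠] 0)
          (𝓝 (C * ‖w (ψ p)‖)) :=
        (((h7.continuousAt.comp h5.1.continuousAt).norm.tendsto.comp hl).const_mul C)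
      rw [h8, norm_zero, mul_zero] at hwt
      have hle := le_of_tendsto_of_tendsto hQt hwt (by
        filter_upwards [hl.eventually h1, hl.eventually h3, hl.eventually h4,
          self_mem_nhdsWithin] with t g1 g2 g3 g4
        refine g1 ?_
        rw [g2]
        refine mul_ne_zero ?_ g3
        simpa [hp2] using g4)
      exact norm_le_zero_iff.mp hle
    -- Division needs `Q = 0` on all zeros of `w` near `ψ q`; by `zeros` each of them comes from a
    -- parameter close to `q`.
    obtain ⟨Q', hQ', hQQ'⟩ := exists_holomorphic_eq_mul h.holomorphic h.map_eq_zero h.submersion hQ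
      (by
        filter_upwards [h.zeros _ hon] with e he h0
        obtain ⟨p, hp, rfl⟩ := he h0
        exact hp h0)
    refine ⟨Q', hQ', ?_⟩
    filter_upwards [hGQ, hQQ'] with e h1 h2
    rw [h1, h2, pow_succ, mul_assoc]

variable [FiniteDimensional ℂ V]

/-- A linear left inverse of the derivative of the slice, composed with the slice, is a local
biholomorphism; its inverse after the linear projection is the coordinate. -/
theorem exists_leaf_coordinate (h : IsLeafParametrization ψ w q) :
    ∃ κ : E → V, (∀ᶠ e in 𝓝 (ψ q), DifferentiableAt ℂ κ e) ∧ ∀ᶠ z in 𝓝 q.1, κ (ψ (z, q.2)) = z := by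
  set A := fderiv ℂ (fun z => ψ (z, q.2)) q.1 with hA
  obtain ⟨P, hP⟩ := LinearMap.exists_leftInverse_of_injective (A : V →ₗ[ℂ] E)
    (LinearMap.ker_eq_bot.mpr h.slice_injective)
  let P' : E →L[ℂ] V := LinearMap.toContinuousLinearMap P
  have hPA : P'.comp A = ((ContinuousLinearEquiv.refl ℂ V : V ≃L[ℂ] V) : V →L[ℂ] V) := by
    ext v; exact DFunLike.congr_fun hP v
  have hd : HasFDerivAt (fun z => P' (ψ (z, q.2)))
      ((ContinuousLinearEquiv.refl ℂ V : V ≃L[ℂ] V) : V →L[ℂ] V) q.1 := by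
    rw [← hPA]
    exact HasFDerivAt.comp (f := fun z => ψ (z, q.2)) q.1 P'.hasFDerivAt h.hasFDerivAt_slice.1
  obtain ⟨g, hg, -, hl, -⟩ := exists_holomorphic_local_inverse (by
    filter_upwards [LeafwiseHolomorphicAt.slice (z := q.1) (u := q.2) h.leafwise] with z hz
    exact P'.differentiableAt.comp z hz) _ hd
  refine ⟨fun e => g (P' e), ?_, hl⟩
  filter_upwards [(P'.continuous.tendsto _).eventually hg] with e he
  exact he.comp e P'.differentiableAt

theorem exists_extension (h : IsLeafParametrization ψ w q) {a : V → ℂ}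
    (ha : ∀ᶠ z in 𝓝 q.1, DifferentiableAt ℂ a z) :
    ∃ A : E → ℂ, (∀ᶠ e in 𝓝 (ψ q), DifferentiableAt ℂ A e) ∧
      ∀ᶠ z in 𝓝 q.1, A (ψ (z, q.2)) = a z := by
  obtain ⟨κ, hκ, hκ'⟩ := h.exists_leaf_coordinate
  have hκq : κ (ψ q) = q.1 := hκ'.self_of_nhds
  have ht := hκ.self_of_nhds.continuousAt.tendsto
  rw [hκq] at ht
  refine ⟨fun e => a (κ e), ?_, hκ'.mono fun z hz => congrArg a hz⟩
  filter_upwards [hκ, ht.eventually ha] with e h1 h2 using h2.comp e h1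

variable [FiniteDimensional ℝ V]

/-- Taylor expansion in `u`, with `w` in place of `u - u₀`. The leading coefficient of the error is
holomorphic on the leaf, extends to a holomorphic function on `E`, and is removed by subtracting a
multiple of `w^k`. -/
theorem exists_jet (h : IsLeafParametrization ψ w q) {f : V × ℝ → ℂ}
    (hf : LeafwiseHolomorphicAt f q) (k : ℕ) :
    ∃ G : E → ℂ, (∀ᶠ e in 𝓝 (ψ q), DifferentiableAt ℂ G e) ∧
      ∃ ρ : V × ℝ → ℂ, LeafwiseHolomorphicAt ρ q ∧
        ∀ᶠ p in 𝓝 q, G (ψ p) - f p = ((p.2 - q.2 : ℝ) : ℂ) ^ k * ρ p := by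
  obtain ⟨v, hv, hvq, hwv⟩ := h.exists_factor
  induction k with
  | zero =>
    exact ⟨fun _ => 0, Eventually.of_forall fun _ => by fun_prop, fun p => 0 - f p,
      (LeafwiseHolomorphicAt.const 0 q).sub hf, Eventually.of_forall fun p => by simp⟩
  | succ k ih =>
    obtain ⟨G, hG, ρ, hρ, hGρ⟩ := ih
    have hslice : Tendsto (fun z : V => (z, q.2)) (𝓝 q.1) (𝓝 q) :=
      Continuous.tendsto (by fun_prop) q.1
    have hv0 : ∀ᶠ z in 𝓝 q.1, v (z, q.2) ≠ 0 :=
      hslice.eventually (hv.continuousAt.eventually_ne hvq)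
    -- The denominator compensates `w^k = (u - u₀)^k v^k`, so that `ρ - A v^k` vanishes on the leaf
    -- and is divisible by `u - u₀`.
    obtain ⟨A, hA, hA'⟩ := h.exists_extension (a := fun z => ρ (z, q.2) / v (z, q.2) ^ k) (by
      filter_upwards [hv0, LeafwiseHolomorphicAt.slice (z := q.1) (u := q.2) hρ,
        LeafwiseHolomorphicAt.slice (z := q.1) (u := q.2) hv] with z h1 h2 h3
      simpa only [div_eq_mul_inv] using h2.fun_mul ((h3.fun_pow k).fun_inv (pow_ne_zero k h1)))
    have hρ' : LeafwiseHolomorphicAt (fun p => ρ p - A (ψ p) * v p ^ k) q :=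
      hρ.sub ((h.leafwise.holomorphic_comp hA).mul (hv.pow k))
    obtain ⟨ρ₁, hρ₁, hρ₁'⟩ := LeafwiseHolomorphicAt.exists_eq_mul (z := q.1) (u := q.2) hρ' (by
      filter_upwards [hA', hv0] with z h1 h2
      rw [h1]
      field_simp
      ring)
    refine ⟨fun e => G e - A e * w e ^ k, ?_, ρ₁, hρ₁, ?_⟩
    · filter_upwards [hG, hA, h.holomorphic] with e h1 h2 h3
      fun_prop
    · filter_upwards [hGρ, hρ₁', hwv] with p h1 h2 h3
      rw [h3, pow_succ, mul_assoc, ← h2]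
      linear_combination h1

theorem exists_jet_bound (h : IsLeafParametrization ψ w q) {f : V × ℝ → ℂ}
    (hf : LeafwiseHolomorphicAt f q) (k : ℕ) :
    ∃ G : E → ℂ, (∀ᶠ e in 𝓝 (ψ q), DifferentiableAt ℂ G e) ∧
      ∃ C : ℝ, ∀ᶠ p in 𝓝 q, ‖G (ψ p) - f p‖ ≤ C * ‖w (ψ p)‖ ^ k := by
  obtain ⟨v, hv, hvq, hwv⟩ := h.exists_factor
  obtain ⟨G, hG, ρ, hρ, hGρ⟩ := h.exists_jet hf k
  have hc : ContinuousAt (fun p => ‖ρ p / v p ^ k‖) q :=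
    (hρ.continuousAt.div (hv.continuousAt.pow k) (pow_ne_zero k hvq)).norm
  refine ⟨G, hG, ‖ρ q / v q ^ k‖ + 1, ?_⟩
  filter_upwards [hwv, hGρ, hv.continuousAt.eventually_ne hvq,
    hc.eventually_lt_const (lt_add_one _)] with p h1 h2 h3 h4
  have : G (ψ p) - f p = ρ p / v p ^ k * w (ψ p) ^ k := by
    rw [h2, h1, mul_pow]
    field_simp
  rw [this, norm_mul, norm_pow (w (ψ p))]
  gcongr

end IsLeafParametrization

end LocalModel

/-! ### Holomorphy read in charts of the complex manifold. -/

section Manifold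

variable {n : ℕ} {X : Type*} [TopologicalSpace X] [ChartedSpace (Cn (n + 1)) X]

theorem isManifold_real_of_complex [IsManifold 𝓘(ℂ, Cn (n + 1)) ω X] :
    IsManifold 𝓘(ℝ, Cn (n + 1)) ∞ X := by
  refine isManifold_of_contDiffOn _ _ _ fun e e' he he' => ?_
  have h := (contDiffGroupoid ω 𝓘(ℂ, Cn (n + 1))).compatible he he'
  rw [contDiffGroupoid, mem_groupoid_of_pregroupoid] at h
  exact (ContDiffOn.restrict_scalars ℝ h.1).of_le (by simp)

variable [IsManifold 𝓘(ℂ, Cn (n + 1)) ω X]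

theorem mdifferentiableAt_chart_complex {x y : X} (hy : y ∈ (chartAt (Cn (n + 1)) x).source) :
    MDifferentiableAt 𝓘(ℂ, Cn (n + 1)) 𝓘(ℂ, Cn (n + 1)) (chartAt (Cn (n + 1)) x) y :=
  (mdifferentiable_chart x).mdifferentiableAt hy

/-- A holomorphic function is holomorphic in a chart. -/
theorem differentiableAt_comp_chart_symm {x : X} {e : Cn (n + 1)}
    (he : e ∈ (chartAt (Cn (n + 1)) x).target) {F : X → ℂ}
    (hF : MDifferentiableAt 𝓘(ℂ, Cn (n + 1)) 𝓘(ℂ, ℂ) F ((chartAt (Cn (n + 1)) x).symm e)) :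
    DifferentiableAt ℂ (fun e => F ((chartAt (Cn (n + 1)) x).symm e)) e :=
  (MDifferentiableAt.comp e hF
    ((mdifferentiable_chart x).mdifferentiableAt_symm he)).differentiableAt

theorem eventually_differentiableAt_comp_chart_symm {x : X} {F : X → ℂ}
    (hF : ∀ᶠ y in 𝓝 x, MDifferentiableAt 𝓘(ℂ, Cn (n + 1)) 𝓘(ℂ, ℂ) F y) :
    ∀ᶠ e in 𝓝 (chartAt (Cn (n + 1)) x x),
      DifferentiableAt ℂ (fun e => F ((chartAt (Cn (n + 1)) x).symm e)) e := by
  filter_upwards [chart_target_mem_nhds (Cn (n + 1)) x,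
    ((chartAt (Cn (n + 1)) x).tendsto_symm (mem_chart_source _ x)).eventually hF] with e h1 h2
  exact differentiableAt_comp_chart_symm h1 h2

theorem eventually_mdifferentiableAt_comp_chart {x : X} {G : Cn (n + 1) → ℂ}
    (hG : ∀ᶠ e in 𝓝 (chartAt (Cn (n + 1)) x x), DifferentiableAt ℂ G e) :
    ∀ᶠ y in 𝓝 x, MDifferentiableAt 𝓘(ℂ, Cn (n + 1)) 𝓘(ℂ, ℂ)
      (fun y => G (chartAt (Cn (n + 1)) x y)) y := by
  have hs := mem_chart_source (Cn (n + 1)) x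
  filter_upwards [chart_source_mem_nhds (Cn (n + 1)) x,
    ((chartAt (Cn (n + 1)) x).continuousAt hs).eventually hG] with y h1 h2
  exact MDifferentiableAt.comp y h2.mdifferentiableAt (mdifferentiableAt_chart_complex h1)

/-- A map to `X` that is smooth, and holomorphic in the first variable, has these properties in a
chart. -/
theorem leafwiseHolomorphicAt_chart_comp {x : X} {g : Cn n × ℝ → X} {q : Cn n × ℝ}
    (hx : g q ∈ (chartAt (Cn (n + 1)) x).source)
    (hg : ∀ᶠ p in 𝓝 q, ContMDiffAt 𝓘(ℝ, Cn n × ℝ) 𝓘(ℝ, Cn (n + 1)) ∞ g p ∧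
      MDifferentiableAt 𝓘(ℂ, Cn n) 𝓘(ℂ, Cn (n + 1)) (fun z => g (z, p.2)) p.1) :
    LeafwiseHolomorphicAt (fun p => chartAt (Cn (n + 1)) x (g p)) q := by
  have := isManifold_real_of_complex (n := n) (X := X)
  have hgc : ContinuousAt g q := hg.self_of_nhds.1.continuousAt
  filter_upwards [hg, hgc.eventually ((chartAt (Cn (n + 1)) x).open_source.mem_nhds hx)]
    with p h1 h2
  have h3 : ContDiffAt ℝ ∞ (fun p => chartAt (Cn (n + 1)) x (g p)) p := by
    rw [← contMDiffAt_iff_contDiffAt]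
    exact ((contMDiffOn_chart (I := 𝓘(ℝ, Cn (n + 1))) (n := ∞) (x := x)).contMDiffAt
      ((chartAt (Cn (n + 1)) x).open_source.mem_nhds h2)).comp p h1.1
  refine ⟨h3, fun v => ?_⟩
  have h4 : DifferentiableAt ℂ (fun z => chartAt (Cn (n + 1)) x (g (z, p.2))) p.1 :=
    (MDifferentiableAt.comp p.1 (g := chartAt (Cn (n + 1)) x)
      (mdifferentiableAt_chart_complex h2) h1.2).differentiableAt
  have h5 := HasFDerivAt.comp (𝕜 := ℝ) (f := fun z : Cn n => (z, p.2)) p.1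
    (h3.differentiableAt (by simp)).hasFDerivAt (hasFDerivAt_prodMk_left p.1 p.2)
  have h6 := fderiv_real_I_smul h4 v
  have h7 : fderiv ℝ (fun z => chartAt (Cn (n + 1)) x (g (z, p.2))) p.1 = _ := h5.fderiv
  rw [h7] at h6
  simpa using h6

end Manifold

/-! ### Defining functions of a hypersurface. -/

section Hypersurface

variable (n : ℕ) {X : Type*} [TopologicalSpace X] [ChartedSpace (Cn (n + 1)) X]

/-- `w` is a defining function of the hypersurface `S` on the open set `W`. -/
structure IsDefiningFunction (S : Set X) (w : X → ℂ) (W : Set X) : Prop where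
  isOpen : IsOpen W
  holomorphic : MDifferentiableOn 𝓘(ℂ, Cn (n + 1)) 𝓘(ℂ, ℂ) w W
  submersion : ∀ y ∈ W, mfderiv 𝓘(ℂ, Cn (n + 1)) 𝓘(ℂ, ℂ) w y ≠ 0
  mem_iff : ∀ y ∈ W, y ∈ S ↔ w y = 0

variable {n} {S : Set X} {w : X → ℂ} {W : Set X}

theorem IsDefiningFunction.mono (h : IsDefiningFunction n S w W) {W' : Set X} (hW' : IsOpen W')
    (hWW' : W' ⊆ W) : IsDefiningFunction n S w W' :=
  ⟨hW', h.holomorphic.mono hWW', fun y hy => h.submersion y (hWW' hy),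
    fun y hy => h.mem_iff y (hWW' hy)⟩

theorem IsDefiningFunction.eventually_mdifferentiableAt (h : IsDefiningFunction n S w W) {x : X}
    (hx : x ∈ W) : ∀ᶠ y in 𝓝 x, MDifferentiableAt 𝓘(ℂ, Cn (n + 1)) 𝓘(ℂ, ℂ) w y := by
  filter_upwards [h.isOpen.mem_nhds hx] with y hy
  exact h.holomorphic.mdifferentiableAt (h.isOpen.mem_nhds hy)

variable [IsManifold 𝓘(ℂ, Cn (n + 1)) ω X]

theorem IsDefiningFunction.fderiv_chart_ne_zero (h : IsDefiningFunction n S w W) {x : X}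
    (hx : x ∈ W) : fderiv ℂ (fun e => w ((chartAt (Cn (n + 1)) x).symm e))
      (chartAt (Cn (n + 1)) x x) ≠ 0 := by
  intro h0
  apply h.submersion x hx
  have hs := mem_chart_source (Cn (n + 1)) x
  have h1 : w =ᶠ[𝓝 x] (fun e => w ((chartAt (Cn (n + 1)) x).symm e)) ∘ chartAt (Cn (n + 1)) x := by
    filter_upwards [chart_source_mem_nhds (Cn (n + 1)) x] with y hy
    simp [(chartAt (Cn (n + 1)) x).left_inv hy]
  have h2 := (eventually_differentiableAt_comp_chart_symm
    (h.eventually_mdifferentiableAt hx)).self_of_nhds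
  rw [h1.mfderiv_eq, mfderiv_comp x h2.mdifferentiableAt (mdifferentiableAt_chart_complex hs),
    mfderiv_eq_fderiv, h0]
  exact ContinuousLinearMap.zero_comp _

end Hypersurface

/-! ### Foliation charts as leaf parametrizations. -/

namespace LeviFlatHypersurface

variable {n : ℕ} {X : Type*} [TopologicalSpace X] [ChartedSpace (Cn (n + 1)) X]
  {M : LeviFlatHypersurface n X} {x₀ : M.carrier}

theorem leaf_subset_carrier : M.leaf x₀ ⊆ M.carrier := by
  rintro _ ⟨y, -, rfl⟩
  exact y.2

theorem symm_mem_leaf {x : M.carrier} (hx : (x : X) ∈ M.leaf x₀) {c : FoliationChart n M.carrier}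
    (hc : c ∈ M.charts) (hxc : x ∈ c.φ.source) {z : Cn n} (hz : z ∈ c.Ω) :
    (c.φ.symm (z, (c.φ x).2) : X) ∈ M.leaf x₀ := by
  obtain ⟨y, hy, hyx⟩ := hx
  obtain rfl : y = x := Subtype.ext hyx
  have hmem : (z, (c.φ y).2) ∈ c.φ.target := by
    have := c.φ.map_source hxc
    rw [c.target_eq] at this ⊢
    exact ⟨hz, this.2⟩
  refine ⟨_, Relation.EqvGen.trans _ _ _ hy (Relation.EqvGen.rel _ _
    ⟨c, hc, (c.φ y).2, ⟨hxc, rfl⟩, c.φ.map_target hmem, ?_⟩), rfl⟩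
  simp [FoliationChart.u, c.φ.right_inv hmem]

theorem eventually_contMDiffAt (c : FoliationChart n M.carrier) {q : Cn n × ℝ}
    (hq : q ∈ c.φ.target) {g : Cn n × ℝ → X}
    (hg : ContMDiffOn 𝓘(ℝ, Cn n × ℝ) 𝓘(ℝ, Cn (n + 1)) ∞ g c.φ.target)
    (hg' : ∀ u ∈ Ioo (0 : ℝ) 1,
      MDifferentiableOn 𝓘(ℂ, Cn n) 𝓘(ℂ, Cn (n + 1)) (fun z => g (z, u)) c.Ω) :
    ∀ᶠ p in 𝓝 q, ContMDiffAt 𝓘(ℝ, Cn n × ℝ) 𝓘(ℝ, Cn (n + 1)) ∞ g p ∧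
      MDifferentiableAt 𝓘(ℂ, Cn n) 𝓘(ℂ, Cn (n + 1)) (fun z => g (z, p.2)) p.1 := by
  filter_upwards [c.φ.open_target.mem_nhds hq] with p hp
  refine ⟨hg.contMDiffAt (c.φ.open_target.mem_nhds hp), ?_⟩
  rw [c.target_eq] at hp
  exact (hg' p.2 hp.2).mdifferentiableAt (c.isOpen_Ω.mem_nhds hp.1)

variable [IsManifold 𝓘(ℂ, Cn (n + 1)) ω X]

theorem isLeafParametrization_chart {x : M.carrier} (hx : (x : X) ∈ M.leaf x₀)
    {c : FoliationChart n M.carrier} (hc : c ∈ M.charts) (hxc : x ∈ c.φ.source)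
    {w : X → ℂ} {W : Set X} (hw : IsDefiningFunction n (M.leaf x₀) w W) (hxW : (x : X) ∈ W) :
    IsLeafParametrization (fun q => chartAt (Cn (n + 1)) (x : X) (c.φ.symm q))
      (fun e => w ((chartAt (Cn (n + 1)) (x : X)).symm e)) (c.φ x) := by
  have hreal := isManifold_real_of_complex (n := n) (X := X)
  set χ := chartAt (Cn (n + 1)) (x : X) with hχ
  have hs : (x : X) ∈ χ.source := mem_chart_source (Cn (n + 1)) (x : X)
  have hq : c.φ x ∈ c.φ.target := c.φ.map_source hxc
  have hqx : c.φ.symm (c.φ x) = x := c.φ.left_inv hxc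
  have hsmooth := eventually_contMDiffAt c hq c.smooth c.holomorphic
  have hψ : LeafwiseHolomorphicAt (fun q => χ (c.φ.symm q)) (c.φ x) :=
    leafwiseHolomorphicAt_chart_comp (by rw [hqx]; exact hs) hsmooth
  have hval : Tendsto (fun q => (c.φ.symm q : X)) (𝓝 (c.φ x)) (𝓝 (x : X)) := by
    have := hsmooth.self_of_nhds.1.continuousAt.tendsto
    rwa [hqx] at this
  have hW := hw.isOpen.mem_nhds hxW
  have hsource : χ.source ∈ 𝓝 (x : X) := χ.open_source.mem_nhds hs
  refine ⟨hψ, ?_, by simp, ?_, ?_, ?_, ?_⟩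
  · have h1 : MDifferentiableAt 𝓘(ℝ, Cn (n + 1)) 𝓘(ℝ, Cn (n + 1)) χ (c.φ.symm (c.φ x) : X) :=
      (mdifferentiable_chart (I := 𝓘(ℝ, Cn (n + 1))) (x : X)).mdifferentiableAt (by rwa [hqx])
    have h2 := mfderiv_comp (c.φ x) (g := χ) (f := fun q => (c.φ.symm q : X)) h1
      (hsmooth.self_of_nhds.1.mdifferentiableAt (by simp))
    rw [mfderiv_eq_fderiv] at h2
    have h3 : fderiv ℝ (fun q => χ (c.φ.symm q : X)) (c.φ x) = _ := h2
    rw [h3]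
    exact ((mdifferentiable_chart (I := 𝓘(ℝ, Cn (n + 1))) (x : X)).mfderiv_injective
      (by rwa [hqx])).comp (c.immersion _ hq)
  · simp only [hqx]
    exact eventually_differentiableAt_comp_chart_symm (hw.eventually_mdifferentiableAt hxW)
  · simp only [hqx]
    exact hw.fderiv_chart_ne_zero hxW
  · have hslice : Tendsto (fun z => (z, (c.φ x).2)) (𝓝 (c.φ x).1) (𝓝 (c.φ x)) :=
      Continuous.tendsto (by fun_prop) (c.φ x).1
    have hΩ : (c.φ x).1 ∈ c.Ω := by
      have h := hq
      rw [c.target_eq] at h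
      exact h.1
    filter_upwards [c.isOpen_Ω.mem_nhds hΩ, (hval.comp hslice).eventually hW,
      (hval.comp hslice).eventually hsource] with z h1 h2 h3
    have h4 : χ.symm (χ (c.φ.symm (z, (c.φ x).2) : X)) = c.φ.symm (z, (c.φ x).2) := χ.left_inv h3
    rw [h4]
    exact (hw.mem_iff _ h2).mp (symm_mem_leaf hx hc hxc h1)
  -- Embeddedness enters here: a zero of `w` near `x` lies in the leaf, hence in `M`, and since `M`
  -- has the subspace topology it lies in the given chart neighbourhood of `x`.
  · intro N hN
    have h1 : ∀ᶠ y : M.carrier in 𝓝 x, c.φ y ∈ N ∧ y ∈ c.φ.source :=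
      ((c.φ.continuousAt hxc).eventually hN).and (c.φ.open_source.mem_nhds hxc)
    rw [nhds_subtype_eq_comap, eventually_comap] at h1
    have h2 : ∀ᶠ y in 𝓝 (x : X), w y = 0 → ∃ y' : M.carrier, (y' : X) = y ∧ c.φ y' ∈ N ∧
        y' ∈ c.φ.source := by
      filter_upwards [h1, hW] with y h3 h4 h5
      have hy := leaf_subset_carrier ((hw.mem_iff y h4).mpr h5)
      exact ⟨⟨y, hy⟩, rfl, h3 ⟨y, hy⟩ rfl⟩
    simp only [hqx]
    filter_upwards [(χ.tendsto_symm hs).eventually h2, χ.open_target.mem_nhds (χ.map_source hs)]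
      with e h3 h4 h5
    obtain ⟨y', h6, h7, h8⟩ := h3 h5
    refine ⟨c.φ y', h7, ?_⟩
    simp only [c.φ.left_inv h8, h6]
    exact χ.right_inv h4

end LeviFlatHypersurface

/-! ### Local extension, osculating functions and their uniqueness. -/

/-- `G` is a holomorphic function on `W` that agrees along the hypersurface `S ⊆ M` with the function
`g` on `M` up to terms of order `k`. -/
structure IsOsculating (n : ℕ) {X : Type*} [TopologicalSpace X] [ChartedSpace (Cn (n + 1)) X]
    {M : Set X} (S : Set X) (g : M → ℂ) (k : ℕ) (w G : X → ℂ) (W : Set X) : Prop where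
  defining : IsDefiningFunction n S w W
  holomorphic : MDifferentiableOn 𝓘(ℂ, Cn (n + 1)) 𝓘(ℂ, ℂ) G W
  bound : ∃ C : ℝ, ∀ m : M, (m : X) ∈ W → ‖G m - g m‖ ≤ C * ‖w m‖ ^ k

namespace LeviFlatHypersurface

variable {n : ℕ} {X : Type*} [TopologicalSpace X] [ChartedSpace (Cn (n + 1)) X]
  [IsManifold 𝓘(ℂ, Cn (n + 1)) ω X] {M : LeviFlatHypersurface n X} {x₀ : M.carrier}

/-- A holomorphic function on an embedded leaf extends locally to a holomorphic function. -/
theorem exists_local_extension (hL : IsComplexHypersurface n (M.leaf x₀))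
    (f : HolomorphicFunctions n (M.leaf x₀)) {x : M.carrier} (hx : (x : X) ∈ M.leaf x₀) :
    ∃ F : Cn (n + 1) → ℂ,
      (∀ᶠ e in 𝓝 (chartAt (Cn (n + 1)) (x : X) x), DifferentiableAt ℂ F e) ∧
      ∀ᶠ y in 𝓝 (x : X), ∀ hy : y ∈ M.leaf x₀, F (chartAt (Cn (n + 1)) (x : X) y) = f.1 ⟨y, hy⟩ := by
  classical
  obtain ⟨c, hc, hxc⟩ := M.cover x
  obtain ⟨W, hWo, hxW, w, hw, hw', hw0⟩ := hL x hx
  have hdef : IsDefiningFunction n (M.leaf x₀) w W := ⟨hWo, hw, hw', hw0⟩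
  have hpar := isLeafParametrization_chart hx hc hxc hdef hxW
  set χ := chartAt (Cn (n + 1)) (x : X) with hχ
  have hs : (x : X) ∈ χ.source := mem_chart_source (Cn (n + 1)) (x : X)
  have hq : c.φ x ∈ c.φ.target := c.φ.map_source hxc
  have hqx : c.φ.symm (c.φ x) = x := c.φ.left_inv hxc
  have hq' := hq
  rw [c.target_eq] at hq'
  let ι : Cn n → M.leaf x₀ := fun z =>
    if h : (c.φ.symm (z, (c.φ x).2) : X) ∈ M.leaf x₀ then ⟨_, h⟩ else ⟨x, hx⟩
  have hι : ∀ z ∈ c.Ω, (ι z : X) = c.φ.symm (z, (c.φ x).2) := fun z hz => by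
    simp only [ι, dif_pos (symm_mem_leaf hx hc hxc hz)]
  have hfι := f.2 c.Ω ι c.isOpen_Ω ((c.holomorphic _ hq'.2).congr hι)
  obtain ⟨F, hF, hF'⟩ := hpar.exists_extension (a := fun z => f.1 (ι z)) (by
    filter_upwards [c.isOpen_Ω.mem_nhds hq'.1] with z hz
    exact hfι.differentiableAt (c.isOpen_Ω.mem_nhds hz))
  obtain ⟨v, hv, hvq, hwv⟩ := hpar.exists_factor
  simp only [hqx] at hF
  refine ⟨F, hF, ?_⟩
  have hfst : Tendsto Prod.fst (𝓝 (c.φ x)) (𝓝 (c.φ x).1) := continuous_fst.tendsto _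
  have hψs : ∀ᶠ q in 𝓝 (c.φ x), (c.φ.symm q : X) ∈ χ.source := by
    have : ContinuousAt (fun q => (c.φ.symm q : X)) (c.φ x) :=
      continuous_subtype_val.continuousAt.comp (c.φ.continuousAt_symm hq)
    exact this.eventually (χ.open_source.mem_nhds (by simpa only [hqx] using hs))
  -- The extension is so far controlled only on the plaque of `x`. Any point of the leaf near `x` is
  -- `ψ q` with `q` near `c.φ x`, and `w = (u - u₀) v` with `v ≠ 0` then forces `u = u₀`: no other
  -- plaque of the leaf accumulates at `x`.
  have hz := hpar.zeros _ (hwv.and ((hv.continuousAt.eventually_ne hvq).and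
    ((hfst.eventually hF').and ((hfst.eventually (c.isOpen_Ω.mem_nhds hq'.1)).and hψs))))
  simp only [hqx] at hz
  filter_upwards [hWo.mem_nhds hxW, χ.open_source.mem_nhds hs,
    (χ.continuousAt hs).eventually hz] with y hyW hys h1 hy
  have hwy : w (χ.symm (χ y)) = 0 := by
    rw [χ.left_inv hys]
    exact (hw0 y hyW).mp hy
  obtain ⟨q, ⟨h2, h3, h4, h5, h6⟩, h7⟩ := h1 hwy
  have h8 : q.2 = (c.φ x).2 := by
    have h9 : w (χ.symm (χ (c.φ.symm q : X))) = 0 := by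
      have h10 : χ (c.φ.symm q : X) = χ y := h7
      rw [h10, hwy]
    rw [h9] at h2
    have := (mul_eq_zero.mp h2.symm).resolve_right h3
    exact sub_eq_zero.mp (by exact_mod_cast this)
  have h9 : (c.φ.symm q : X) = y := χ.injOn h6 hys h7
  have h10 : ι q.1 = ⟨y, hy⟩ := by
    apply Subtype.ext
    rw [hι _ h5, ← h8]
    exact h9
  rw [← h8] at h4
  rw [← h10, ← h4]
  congr 1
  exact h7.symm

variable {p : M.carrier → X}

/-- The pullback of a holomorphic function on the leaf to `M` by the retraction. -/
def pullback (hp : M.IsLeafwiseHolomorphicRetraction (M.leaf x₀) p)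
    (f : HolomorphicFunctions n (M.leaf x₀)) (m : M.carrier) : ℂ :=
  f.1 ⟨p m, hp.maps_to m⟩

/-- Near `x` the pullback is a local holomorphic extension of `f` composed with the retraction,
hence holomorphic along the leaves, and `exists_jet_bound` applies to it. -/
theorem exists_isOsculating (hL : IsComplexHypersurface n (M.leaf x₀))
    (hp : M.IsLeafwiseHolomorphicRetraction (M.leaf x₀) p)
    (f : HolomorphicFunctions n (M.leaf x₀)) (k : ℕ) {x : M.carrier} (hx : (x : X) ∈ M.leaf x₀) :
    ∃ W w G, (x : X) ∈ W ∧ IsOsculating n (M.leaf x₀) (pullback hp f) k w G W := by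
  obtain ⟨F, hF, hFf⟩ := exists_local_extension hL f hx
  obtain ⟨c, hc, hxc⟩ := M.cover x
  obtain ⟨W, hWo, hxW, w, hw, hw', hw0⟩ := hL x hx
  have hdef : IsDefiningFunction n (M.leaf x₀) w W := ⟨hWo, hw, hw', hw0⟩
  have hpar := isLeafParametrization_chart hx hc hxc hdef hxW
  set χ := chartAt (Cn (n + 1)) (x : X) with hχ
  have hs : (x : X) ∈ χ.source := mem_chart_source (Cn (n + 1)) (x : X)
  have hq : c.φ x ∈ c.φ.target := c.φ.map_source hxc
  have hqx : c.φ.symm (c.φ x) = x := c.φ.left_inv hxc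
  have hpx : p (c.φ.symm (c.φ x)) = x := by rw [hqx, hp.retracts x hx]
  have hpsm := eventually_contMDiffAt c hq (hp.smooth c hc) (hp.holomorphic c hc)
  have hpt : Tendsto (fun q => p (c.φ.symm q)) (𝓝 (c.φ x)) (𝓝 (x : X)) := by
    have := hpsm.self_of_nhds.1.continuousAt.tendsto
    rwa [hpx] at this
  have hlh : LeafwiseHolomorphicAt (fun q => pullback hp f (c.φ.symm q)) (c.φ x) := by
    have h1 : LeafwiseHolomorphicAt (fun q => χ (p (c.φ.symm q))) (c.φ x) :=
      leafwiseHolomorphicAt_chart_comp (by rwa [hpx]) hpsm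
    refine (h1.holomorphic_comp (G := F) (by rwa [hpx])).congr ?_
    filter_upwards [hpt.eventually hFf] with q h2
    exact h2 (hp.maps_to _)
  obtain ⟨G, hG, C, hC⟩ := hpar.exists_jet_bound hlh k
  simp only [hqx] at hG
  have hb : ∀ᶠ m : M.carrier in 𝓝 x,
      ‖G (χ m) - pullback hp f m‖ ≤ C * ‖w m‖ ^ k := by
    have hmc : Tendsto (fun m : M.carrier => (m : X)) (𝓝 x) (𝓝 (x : X)) :=
      continuous_subtype_val.tendsto _
    filter_upwards [(c.φ.continuousAt hxc).eventually hC, c.φ.open_source.mem_nhds hxc,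
      hmc.eventually (χ.open_source.mem_nhds hs)] with m h1 h2 h3
    rw [c.φ.left_inv h2] at h1
    have h4 : χ.symm (χ (m : X)) = m := χ.left_inv h3
    rwa [h4] at h1
  rw [nhds_subtype_eq_comap, eventually_comap] at hb
  obtain ⟨W', hW', hW'o, hxW'⟩ := eventually_nhds_iff.mp
    ((eventually_mdifferentiableAt_comp_chart hG).and (hb.and (hWo.mem_nhds hxW)))
  exact ⟨W', w, fun y => G (χ y), hxW', hdef.mono hW'o fun y hy => (hW' y hy).2.2,
    fun y hy => (hW' y hy).1.mdifferentiableWithinAt, C, fun m hm => (hW' m hm).2.1 m rfl⟩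

/-- Two functions osculating the same function along the leaf differ by a multiple of the `k`-th
power of a defining function. -/
theorem exists_sub_eq_pow_mul {g : M.carrier → ℂ} {k : ℕ} {w₁ w₂ G₁ G₂ : X → ℂ} {W₁ W₂ : Set X}
    (h₁ : IsOsculating n (M.leaf x₀) g k w₁ G₁ W₁) (h₂ : IsOsculating n (M.leaf x₀) g k w₂ G₂ W₂)
    {x : M.carrier} (hx : (x : X) ∈ M.leaf x₀) (hx₁ : (x : X) ∈ W₁) (hx₂ : (x : X) ∈ W₂) :
    ∃ Q : X → ℂ, (∀ᶠ y in 𝓝 (x : X), MDifferentiableAt 𝓘(ℂ, Cn (n + 1)) 𝓘(ℂ, ℂ) Q y) ∧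
      ∀ᶠ y in 𝓝 (x : X), G₁ y - G₂ y = w₂ y ^ k * Q y := by
  obtain ⟨c, hc, hxc⟩ := M.cover x
  have hpar := isLeafParametrization_chart hx hc hxc h₂.defining hx₂
  set χ := chartAt (Cn (n + 1)) (x : X) with hχ
  have hs : (x : X) ∈ χ.source := mem_chart_source (Cn (n + 1)) (x : X)
  have hq : c.φ x ∈ c.φ.target := c.φ.map_source hxc
  have hqx : c.φ.symm (c.φ x) = x := c.φ.left_inv hxc
  have hmem₁ := h₁.defining.isOpen.mem_nhds hx₁
  have hmem₂ := h₂.defining.isOpen.mem_nhds hx₂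
  have hsymm : Tendsto χ.symm (𝓝 (χ x)) (𝓝 (x : X)) := χ.tendsto_symm hs
  have hxx : χ.symm (χ (x : X)) = x := χ.left_inv hs
  -- The two equations of the leaf differ by a holomorphic factor `R`; bounding `R` near `x` turns
  -- the estimate in `w₁` into one in `w₂`.
  obtain ⟨R, hR, hwR⟩ := exists_holomorphic_eq_mul
    (w := fun e => w₂ (χ.symm e)) (G := fun e => w₁ (χ.symm e)) (x := χ x)
    (eventually_differentiableAt_comp_chart_symm (h₂.defining.eventually_mdifferentiableAt hx₂))
    (by rw [hxx]; exact (h₂.defining.mem_iff _ hx₂).mp hx)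
    (h₂.defining.fderiv_chart_ne_zero hx₂)
    (eventually_differentiableAt_comp_chart_symm (h₁.defining.eventually_mdifferentiableAt hx₁))
    (by
      filter_upwards [hsymm.eventually hmem₁, hsymm.eventually hmem₂] with e he₁ he₂ h0
      exact (h₁.defining.mem_iff _ he₁).mp ((h₂.defining.mem_iff _ he₂).mpr h0))
  obtain ⟨C₁, hC₁⟩ := h₁.bound
  obtain ⟨C₂, hC₂⟩ := h₂.bound
  have hval : Tendsto (fun q => (c.φ.symm q : X)) (𝓝 (c.φ x)) (𝓝 (x : X)) := by
    have : ContinuousAt (fun q => (c.φ.symm q : X)) (c.φ x) :=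
      continuous_subtype_val.continuousAt.comp (c.φ.continuousAt_symm hq)
    have := this.tendsto
    rwa [hqx] at this
  have hχx : Tendsto (fun q => χ (c.φ.symm q : X)) (𝓝 (c.φ x)) (𝓝 (χ x)) :=
    (χ.continuousAt hs).tendsto.comp hval
  have hRb : ∀ᶠ e in 𝓝 (χ x), ‖R e‖ < ‖R (χ x)‖ + 1 :=
    hR.self_of_nhds.continuousAt.norm.eventually_lt_const (lt_add_one _)
  obtain ⟨Q, hQ, hGQ⟩ := hpar.exists_eq_pow_mul k
    (G := fun e => G₁ (χ.symm e) - G₂ (χ.symm e))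
    (C := |C₁| * (‖R (χ x)‖ + 1) ^ k + C₂) (by
      simp only [hqx]
      refine eventually_differentiableAt_comp_chart_symm (F := fun y => G₁ y - G₂ y) ?_
      filter_upwards [h₁.defining.isOpen.eventually_mem hx₁,
        h₂.defining.isOpen.eventually_mem hx₂] with y hy₁ hy₂
      exact (h₁.holomorphic.mdifferentiableAt (h₁.defining.isOpen.mem_nhds hy₁)).sub
        (h₂.holomorphic.mdifferentiableAt (h₂.defining.isOpen.mem_nhds hy₂)))
    (by
      filter_upwards [hval.eventually hmem₁, hval.eventually hmem₂,
        hval.eventually (χ.open_source.mem_nhds hs), hχx.eventually hwR, hχx.eventually hRb]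
        with q h3 h4 h5 h6 h7
      have h8 : χ.symm (χ (c.φ.symm q : X)) = c.φ.symm q := χ.left_inv h5
      rw [h8] at h6 ⊢
      set m := c.φ.symm q
      calc ‖G₁ m - G₂ m‖ = ‖(G₁ m - g m) - (G₂ m - g m)‖ := by rw [sub_sub_sub_cancel_right]
        _ ≤ ‖G₁ m - g m‖ + ‖G₂ m - g m‖ := norm_sub_le _ _
        _ ≤ |C₁| * ‖w₁ m‖ ^ k + C₂ * ‖w₂ m‖ ^ k := by
          refine add_le_add ((hC₁ m h3).trans ?_) (hC₂ m h4)
          gcongr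
          exact le_abs_self C₁
        _ ≤ |C₁| * (‖w₂ m‖ * (‖R (χ x)‖ + 1)) ^ k + C₂ * ‖w₂ m‖ ^ k := by
          rw [h6, norm_mul]
          gcongr
        _ = _ := by rw [mul_pow]; ring)
  simp only [hqx] at hQ hGQ
  refine ⟨fun y => Q (χ y), eventually_mdifferentiableAt_comp_chart hQ, ?_⟩
  filter_upwards [(χ.continuousAt hs).eventually hGQ, χ.open_source.mem_nhds hs] with y h1 h2
  rwa [χ.left_inv h2] at h1

end LeviFlatHypersurface

/-! ### From local osculating functions to a global jet. -/

section Jets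

variable {n : ℕ} {X : Type*} [TopologicalSpace X] [ChartedSpace (Cn (n + 1)) X]

/-- The germ at `x` of a function that is holomorphic near `x`. -/
def holomorphicGerm (F : X → ℂ) (x : X)
    (hF : ∀ᶠ y in 𝓝 x, MDifferentiableAt 𝓘(ℂ, Cn (n + 1)) 𝓘(ℂ, ℂ) F y) : holomorphicGerms n x :=
  ⟨(F : Germ (𝓝 x) ℂ), F, hF, rfl⟩

theorem holomorphicGerm_sub_mem {S : Set X} {x : X} {k : ℕ} {G₁ G₂ w Q : X → ℂ}
    (hG₁ : ∀ᶠ y in 𝓝 x, MDifferentiableAt 𝓘(ℂ, Cn (n + 1)) 𝓘(ℂ, ℂ) G₁ y)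
    (hG₂ : ∀ᶠ y in 𝓝 x, MDifferentiableAt 𝓘(ℂ, Cn (n + 1)) 𝓘(ℂ, ℂ) G₂ y)
    (hw : ∀ᶠ y in 𝓝 x, MDifferentiableAt 𝓘(ℂ, Cn (n + 1)) 𝓘(ℂ, ℂ) w y)
    (hQ : ∀ᶠ y in 𝓝 x, MDifferentiableAt 𝓘(ℂ, Cn (n + 1)) 𝓘(ℂ, ℂ) Q y)
    (hw0 : ∀ᶠ y in 𝓝 x, y ∈ S → w y = 0)
    (h : ∀ᶠ y in 𝓝 x, G₁ y - G₂ y = w y ^ k * Q y) :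
    holomorphicGerm G₁ x hG₁ - holomorphicGerm G₂ x hG₂ ∈ idealGerms n S x ^ k := by
  have hmem : holomorphicGerm w x hw ∈ idealGerms n S x := ⟨w, rfl, hw0⟩
  have heq : holomorphicGerm G₁ x hG₁ - holomorphicGerm G₂ x hG₂ =
      holomorphicGerm w x hw ^ k * holomorphicGerm Q x hQ :=
    Subtype.ext (Germ.coe_eq.mpr h)
  rw [heq]
  exact Ideal.mul_mem_right _ _ (Ideal.pow_mem_pow hmem k)

end Jets

theorem proposition3p9 {n : ℕ} {X : Type*} [TopologicalSpace X] [T2Space X]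
    [ChartedSpace (Cn (n + 1)) X] [IsManifold 𝓘(ℂ, Cn (n + 1)) ω X]
    (M : LeviFlatHypersurface n X) (x₀ : M.carrier)
    (hL : IsComplexHypersurface n (M.leaf x₀))
    (c₀ : FoliationChart n M.carrier) (hc₀ : c₀ ∈ M.charts) (hx₀ : x₀ ∈ c₀.φ.source)
    (hol : ∃ G : Set DiffGerm, (∀ g ∈ G, g.IsFlat 2) ∧
      (Subgroup.closure G : Set DiffGerm) = M.holonomyGroup x₀ c₀)
    (p : M.carrier → X) (hp : M.IsLeafwiseHolomorphicRetraction (M.leaf x₀) p) :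
    HasJetExtensionProperty n (M.leaf x₀) := by
  intro k _ f
  have hex : ∀ x : M.leaf x₀, ∃ W w G, (x : X) ∈ W ∧
      IsOsculating n (M.leaf x₀) (LeviFlatHypersurface.pullback hp f) (k + 1) w G W := fun x =>
    LeviFlatHypersurface.exists_isOsculating hL hp f (k + 1)
      (x := ⟨x, LeviFlatHypersurface.leaf_subset_carrier x.2⟩) x.2
  choose W w G hxW hG using hex
  have hhol : ∀ (x : M.leaf x₀) (y : X), y ∈ W x →
      ∀ᶠ z in 𝓝 y, MDifferentiableAt 𝓘(ℂ, Cn (n + 1)) 𝓘(ℂ, ℂ) (G x) z := by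
    intro x y hy
    filter_upwards [(hG x).defining.isOpen.mem_nhds hy] with z hz
    exact (hG x).holomorphic.mdifferentiableAt ((hG x).defining.isOpen.mem_nhds hz)
  refine ⟨⟨fun x => Ideal.Quotient.mk _ (holomorphicGerm (G x) x (hhol x x (hxW x))),
    fun x => ⟨W x, (hG x).defining.isOpen, hxW x, G x, (hG x).holomorphic, fun y hy =>
      ⟨holomorphicGerm (G x) y (hhol x y hy), rfl, ?_⟩⟩⟩, ?_⟩
  -- At `y`, the section is defined by `G y`, while near `x` it should be induced by `G x`; both
  -- osculate the same pullback to order `k + 1`.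
  · rw [Ideal.Quotient.eq]
    obtain ⟨Q, hQ, h⟩ := LeviFlatHypersurface.exists_sub_eq_pow_mul (hG y) (hG x)
      (x := ⟨y, LeviFlatHypersurface.leaf_subset_carrier y.2⟩) y.2 (hxW y) hy
    refine holomorphicGerm_sub_mem _ _ ((hG x).defining.eventually_mdifferentiableAt hy) hQ ?_ h
    filter_upwards [(hG x).defining.isOpen.mem_nhds hy] with z hz
    exact ((hG x).defining.mem_iff z hz).mp
  -- On the leaf `w = 0`, and the exponent `k + 1` is positive, so the osculation bound becomes
  -- equality with the pullback.
  · apply Subtype.ext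
    funext x
    change G x x = f.1 x
    obtain ⟨C, hC⟩ := (hG x).bound
    have h1 := hC ⟨x, LeviFlatHypersurface.leaf_subset_carrier x.2⟩ (hxW x)
    rw [((hG x).defining.mem_iff x (hxW x)).mp x.2, norm_zero, zero_pow k.succ_ne_zero, mul_zero,
      norm_le_zero_iff, sub_eq_zero] at h1
    rw [h1]
    exact congrArg f.1 (Subtype.ext (hp.retracts _ x.2))
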